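/- **Setting.** Let $m\ge 1$, $a>0$, and let $\hat u(\xi)=\int_{\mathbb R^m}u(x)e^{-2\pi i x\cdot\xi}\,dx$ be the Fourier transform on $L^2=L^2(\mathbb R^m)$; let $z^*$ be the complex conjugate of a number $z$ and $T^*$ the adjoint in $L^2$ of an operator $T$. Let $\mathbb L$ be a constant coefficient linear differential operator with symbol $l$ ($\widehat{\mathbb Lu}=l\hat u$, $l$ a polynomial) such that $l(\xi)\neq0$ for all $\xi\in\mathbb R^m$. Let $\mathbb G(u)=\sum_{i=2}^{N}\sum_{k\in J_i}(\mathbb G^1_{i,k}u)\cdots(\mathbb G^i_{i,k}u)$ with finite sets $J_i$ and linear constant coefficient differential operators $\mathbb G^p_{i,k}$ whose symbols $g^p_{i,k}$ satisfy $g^p_{i,k}/l\in L^1$. Let $J_{\mathbb G}\subset\mathbb N^m$ be the finite set of the $\alpha$ for which $\partial^\alpha$ occurs in some $\mathbb G^p_{i,k}$. For $u_0\in H^l=\{u\in L^2: l\hat u\in L^2\}$ write $D\mathbb G(u_0)=\sum_{\alpha\in J_{\mathbb G}}v_\alpha\partial^\alpha$, where $v_\alpha=\sum_{i,k,p}g^p_{i,k,\alpha}\prod_{q\ne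 p}\mathbb G^q_{i,k}u_0$ and $g^p_{i,k,\alpha}$ is the coefficient of $\partial^\alpha$ in $\mathbb G^p_{i,k}$. Let $\mathbb v_\alpha$ be the multiplication by $v_\alpha$ on $L^2$, and $\partial^\alpha\mathbb L^{-1}$ the operator on $L^2$ with Fourier symbol $(2\pi i\xi)^\alpha/l(\xi)$. Let $f_\alpha$ be the function with $\hat f_\alpha(\xi)=(-2\pi i\xi)^\alpha/l(-\xi)$, and let $C_\alpha$ ($\alpha\in J_{\mathbb G}$) be constants such that $$|f_\alpha(x)|\le C_\alpha e^{-a|x|_1}\quad\text{for all }x\in\mathbb R^m,\ \alpha\in J_{\mathbb G},\qquad |x|_1=|x_1|+\dots+|x_m| .$$ For $d>0$ let $\Omega_0=(-d,d)^m$, $\tilde n=n/(2d)$ for $n\in\mathbb Z^m$, and let the Fourier series representation of a function $u$ on $\Omega_0$ be the sequence $u_n=|\Omega_0|^{-1}\int_{\Omega_0}u(x)e^{-2\pi i\tilde n\cdot x}dx$. Let $\mathbb K_\alpha$ be the bounded operator on $L^2$ with $\mathbb K_\alpha=\mathbb 1_{\Omega_0}\mathbb K_\alpha\mathbb 1_{\Omega_0}$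 that acts on Fourier series as the diagonal operator with entries $\big((2\pi i\tilde n)^\alpha/l(\tilde n)\big)^*$. In the $L^2$ operator norm put $$\mathcal Z^\alpha_{u,1}=\big\|\mathbb 1_{\mathbb R^m\setminus\Omega_0}\big((\partial^\alpha\mathbb L^{-1})^*-\mathbb K_\alpha\big)\mathbb v_\alpha^*\big\|,\qquad \mathcal Z^\alpha_{u,2}=\big\|\mathbb 1_{\Omega_0}\big((\partial^\alpha\mathbb L^{-1})^*-\mathbb K_\alpha\big)\mathbb v_\alpha^*\big\| .$$ Let $V_\alpha$, $E_1$ and $E_2$ be the Fourier series representations on $\Omega_0$ of $v_\alpha$, of $x\mapsto e^{2ad}-e^{2ad}\prod_{i=1}^m\big(1-e^{-2ad}\cosh(2ax_i)\big)$ and of $x\mapsto\prod_{i=1}^m\cosh(2ax_i)$. For sequences, $(U,W)_2=\sum_nu_nw_n$, $U*W$ is the discrete convolution and $U^*=(u_n^*)_n$. **Theorem.** There is a rational function $C$, positive on $(0,\infty)$ and depending only on $m$ and $a$, such that the following holds for all $\mathbb L,\mathbb G,(C_\alpha)_\alpha$ and $u_0\in H^l$ as above. (1) If $d>0$ and $u_0=0$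 almost everywhere outside $\Omega_0=(-d,d)^m$, then for every $\alpha\in J_{\mathbb G}$ the series that define $(V_\alpha^*,V_\alpha*E_1)_2$ and $(V_\alpha^*,V_\alpha*E_2)_2$ converge absolutely, their values are nonnegative real numbers, and $$(\mathcal Z^\alpha_{u,1})^2\le e^{-2ad}|\Omega_0|\frac{C_\alpha^2}{a^m}(V_\alpha^*,V_\alpha*E_1)_2,$$ $$(\mathcal Z^\alpha_{u,2})^2\le(\mathcal Z^\alpha_{u,1})^2+e^{-4ad}C(d)C_\alpha^2|\Omega_0|(V_\alpha^*,V_\alpha*E_2)_2 .$$ (2) If $d_0>0$ and $u_0=0$ almost everywhere outside $(-d_0,d_0)^m$, then there is a constant $M$ such that for all $d\ge d_0$ $$\sum_{\alpha\in J_{\mathbb G}}\sqrt{(\mathcal Z^\alpha_{u,1})^2+(\mathcal Z^\alpha_{u,2})^2}\le Me^{-ad}.$$ -/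

import Mathlib

open MeasureTheory FourierTransform
open scoped ENNReal

noncomputable section

namespace UnboundedPDE

/-! ### Euclidean space, `L²`, and the cube `Ω₀ = (-d, d)^m` -/

/-- `ℝ^m` with its Euclidean structure. -/
abbrev RR (m : ℕ) : Type := EuclideanSpace ℝ (Fin m)

/-- The complex Hilbert space `L²(ℝ^m)`. -/
abbrev L2 (m : ℕ) : Type := Lp (α := RR m) ℂ 2 (volume : Measure (RR m))

/-- The open cube `Ω₀ = (-d, d)^m`. -/
def cube (m : ℕ) (d : ℝ) : Set (RR m) := {x | ∀ i, -d < x i ∧ x i < d}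

/-- The multiplication operator `u ↦ g u` on `L²`, for `g ∈ L^∞`. -/
def mulOp {m : ℕ} (g : RR m → ℂ) : L2 m →L[ℂ] L2 m :=
  open Classical in
  if h : MemLp g ∞ (volume : Measure (RR m)) then
    (ContinuousLinearMap.mul ℂ ℂ).holderL volume ∞ 2 2 (h.toLp g)
  else 0

/-- Multiplication by the indicator function of `s`. -/
def indOp {m : ℕ} (s : Set (RR m)) : L2 m →L[ℂ] L2 m :=
  mulOp (s.indicator fun _ => (1 : ℂ))

/-- The Fourier transform as a bounded operator of `L²`. -/
def fourierCLM (m : ℕ) : L2 m →L[ℂ] L2 m :=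
  ((Lp.fourierTransformₗᵢ (RR m) ℂ).toContinuousLinearEquiv : L2 m →L[ℂ] L2 m)

/-- The inverse Fourier transform as a bounded operator of `L²`. -/
def fourierInvCLM (m : ℕ) : L2 m →L[ℂ] L2 m :=
  ((Lp.fourierTransformₗᵢ (RR m) ℂ).symm.toContinuousLinearEquiv : L2 m →L[ℂ] L2 m)

/-- The Fourier multiplier `u ↦ 𝓕⁻¹ (σ 𝓕 u)` on `L²`, for `σ ∈ L^∞`. -/
def fourierMult {m : ℕ} (σ : RR m → ℂ) : L2 m →L[ℂ] L2 m :=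
  (fourierInvCLM m).comp ((mulOp σ).comp (fourierCLM m))

/-! ### Constant coefficient differential operators and the nonlinearity -/

/-- The Fourier symbol `ξ ↦ P(2πi ξ₁, …, 2πi ξ_m)` of the differential operator
`P(∂) = ∑_β P_β ∂^β`. Every polynomial in `ξ` is the symbol of exactly one `P`. -/
def symbol {m : ℕ} (P : MvPolynomial (Fin m) ℂ) (ξ : RR m) : ℂ :=
  MvPolynomial.eval (fun j => 2 * (Real.pi : ℂ) * Complex.I * ((ξ j : ℝ) : ℂ)) P

/-- The symbol `(2πi ξ)^α` of `∂^α`. -/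
def dsymbol {m : ℕ} (α : Fin m →₀ ℕ) (ξ : RR m) : ℂ :=
  ∏ j, (2 * (Real.pi : ℂ) * Complex.I * ((ξ j : ℝ) : ℂ)) ^ α j

/-- The function `P(∂)u`, that is, the inverse Fourier transform of `symbol P · û`. -/
def diffOp {m : ℕ} (P : MvPolynomial (Fin m) ℂ) (u : L2 m) : RR m → ℂ :=
  𝓕⁻ (fun ξ : RR m => symbol P ξ * (𝓕 u : L2 m) ξ)

/-- Membership in `H^l = {u ∈ L² : l û ∈ L²}`, where `l` is the symbol of `𝕃 = P(∂)`. -/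
def MemHl {m : ℕ} (P : MvPolynomial (Fin m) ℂ) (u : L2 m) : Prop :=
  MemLp (fun ξ : RR m => symbol P ξ * (𝓕 u : L2 m) ξ) 2 (volume : Measure (RR m))

/-- A purely nonlinear polynomial differential operator
`𝔾(u) = ∑_{i=2}^N ∑_{k ∈ J_i} (𝔾¹_{i,k} u) ⋯ (𝔾ⁱ_{i,k} u)`, where
`𝔾^p_{i,k} = (op i k p)(∂)` is a linear differential operator. -/
structure Nonlinearity (m : ℕ) where
  /-- The order of `𝔾`. -/
  N : ℕ
  two_le : 2 ≤ N
  /-- The finite index sets. -/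
  J : ℕ → Finset ℕ
  /-- The linear differential operators `𝔾^p_{i,k}`, as polynomials in `∂`. -/
  op : (i : ℕ) → ℕ → Fin i → MvPolynomial (Fin m) ℂ

namespace Nonlinearity

variable {m : ℕ}

/-- The finite set `J_𝔾` of the multi-indices of the derivatives that occur in `𝔾`, and hence
in `D𝔾(u₀) = ∑_{α ∈ J_𝔾} v_α ∂^α`. -/
def JG (G : Nonlinearity m) : Finset (Fin m →₀ ℕ) :=
  (Finset.Icc 2 G.N).biUnion fun i => (G.J i).biUnion fun k =>
    Finset.univ.biUnion fun p : Fin i => (G.op i k p).support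

/-- The coefficient `v_α` of `∂^α` in the linearization
`D𝔾(u₀) h = ∑_i ∑_{k ∈ J_i} ∑_p (∏_{q ≠ p} 𝔾^q_{i,k} u₀) 𝔾^p_{i,k} h`. -/
def v (G : Nonlinearity m) (u₀ : L2 m) (α : Fin m →₀ ℕ) (x : RR m) : ℂ :=
  ∑ i ∈ Finset.Icc 2 G.N, ∑ k ∈ G.J i, ∑ p : Fin i,
    MvPolynomial.coeff α (G.op i k p) *
      ∏ q ∈ Finset.univ.erase p, diffOp (G.op i k q) u₀ x

end Nonlinearity

/-! ### Fourier series on the cube -/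

/-- The phase `2πi ñ·x` with `ñ = n / (2d)`. -/
def phase {m : ℕ} (d : ℝ) (n : Fin m → ℤ) (x : RR m) : ℂ :=
  2 * (Real.pi : ℂ) * Complex.I * ((∑ j, ((n j : ℝ) / (2 * d)) * x j : ℝ) : ℂ)

/-- The point `ñ = n / (2d)` of `ℝ^m`. -/
def tilde {m : ℕ} (d : ℝ) (n : Fin m → ℤ) : RR m :=
  WithLp.toLp 2 fun j => (n j : ℝ) / (2 * d)

/-- The Fourier series representation `u_n = |Ω₀|⁻¹ ∫_{Ω₀} u(x) e^{-2πi ñ·x} dx` of `u`. -/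
def fourierSeries {m : ℕ} (d : ℝ) (u : RR m → ℂ) (n : Fin m → ℤ) : ℂ :=
  (((volume.real (cube m d))⁻¹ : ℝ) : ℂ) *
    ∫ x in cube m d, u x * Complex.exp (-(phase d n x))

/-- The function `1_{Ω₀}(x) e^{2πi ñ·x}`. -/
def modeFun {m : ℕ} (d : ℝ) (n : Fin m → ℤ) : RR m → ℂ :=
  (cube m d).indicator fun x => Complex.exp (phase d n x)

/-- The discrete convolution of two sequences over `ℤ^m`. -/
def seqConv {m : ℕ} (U V : (Fin m → ℤ) → ℂ) (n : Fin m → ℤ) : ℂ := ∑' k, U k * V (n - k)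

/-- The pairing `(U, V)₂ = ∑_n u_n v_n`. -/
def seqPair {m : ℕ} (U V : (Fin m → ℤ) → ℂ) : ℂ := ∑' n, U n * V n

/-- The sequence of the complex conjugates. -/
def seqConj {m : ℕ} (U : (Fin m → ℤ) → ℂ) (n : Fin m → ℤ) : ℂ := (starRingEnd ℂ) (U n)

lemma cube_eq (m : ℕ) (d : ℝ) :
    cube m d = (MeasurableEquiv.toLp 2 (Fin m → ℝ)).symm ⁻¹'
      (Set.univ.pi fun _ => Set.Ioo (-d) d) := by
  ext x; simp [cube, Set.mem_pi]

lemma measurableSet_cube (m : ℕ) (d : ℝ) : MeasurableSet (cube m d) := by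
  rw [cube_eq]
  exact (MeasurableEquiv.measurable _) (MeasurableSet.univ_pi fun _ => measurableSet_Ioo)

lemma volume_cube (m : ℕ) (d : ℝ) :
    volume (cube m d) = ENNReal.ofReal (2 * d) ^ m := by
  rw [cube_eq, (EuclideanSpace.volume_preserving_symm_measurableEquiv_toLp (Fin m)).measure_preimage
    (MeasurableSet.univ_pi fun _ => measurableSet_Ioo).nullMeasurableSet, Real.volume_pi_Ioo]
  simp [two_mul]

lemma volume_cube_lt_top (m : ℕ) (d : ℝ) : volume (cube m d) < ∞ := by
  rw [volume_cube]; exact ENNReal.pow_lt_top ENNReal.ofReal_lt_top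

lemma norm_exp_phase {m : ℕ} (d : ℝ) (n : Fin m → ℤ) (x : RR m) :
    ‖Complex.exp (phase d n x)‖ = 1 := by
  have : phase d n x = ((2 * Real.pi * ∑ j, ((n j : ℝ) / (2 * d)) * x j : ℝ) : ℂ) * Complex.I := by
    unfold phase; push_cast; ring
  rw [this, Complex.norm_exp_ofReal_mul_I]

lemma continuous_phase {m : ℕ} (d : ℝ) (n : Fin m → ℤ) :
    Continuous (phase d n : RR m → ℂ) := by
  unfold phase; fun_prop

lemma memLp_modeFun {m : ℕ} (d : ℝ) (n : Fin m → ℤ) :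
    MemLp (modeFun d n) 2 (volume : Measure (RR m)) := by
  unfold modeFun
  rw [memLp_indicator_iff_restrict (measurableSet_cube m d)]
  have : IsFiniteMeasure (volume.restrict (cube m d)) :=
    ⟨by simpa using volume_cube_lt_top m d⟩
  exact MemLp.of_bound
    (Complex.continuous_exp.comp (continuous_phase d n)).aestronglyMeasurable 1
    (Filter.Eventually.of_forall fun x => (norm_exp_phase d n x).le)

/-- `1_{Ω₀}(x) e^{2πi ñ·x}` as an element of `L²(ℝ^m)`. -/
def mode {m : ℕ} (d : ℝ) (n : Fin m → ℤ) : L2 m := (memLp_modeFun d n).toLp (modeFun d n)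

/-- The map `u ↦ 1_{Ω₀} ∑_n k_n u_n e^{2πi ñ·x}`, where `u_n` are the Fourier coefficients of
`u` on `Ω₀`. -/
def periodicFun {m : ℕ} (d : ℝ) (k : (Fin m → ℤ) → ℂ) (u : L2 m) : L2 m :=
  ∑' n, (k n * fourierSeries d u n) • mode d n

/-- The integral of an exponential over a period. -/
lemma integral_exp_period {d : ℝ} (hd : 0 < d) (l : ℤ) :
    ∫ t : ℝ, (Set.Ioo (-d) d).indicator
      (fun t : ℝ => Complex.exp (2 * Real.pi * Complex.I * (((l : ℝ) / (2 * d) * t : ℝ) : ℂ))) t =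
      if l = 0 then ((2 * d : ℝ) : ℂ) else 0 := by
  rw [integral_indicator measurableSet_Ioo, ← integral_Ioc_eq_integral_Ioo,
    ← intervalIntegral.integral_of_le (by linarith)]
  have hd' : (d : ℂ) ≠ 0 := by exact_mod_cast hd.ne'
  split_ifs with h
  · subst h; simp; ring
  · have hc : (2 * Real.pi * Complex.I * ((l : ℂ) / (2 * d)) : ℂ) ≠ 0 := by
      have : (l : ℂ) ≠ 0 := by exact_mod_cast h
      have hpi : (Real.pi : ℂ) ≠ 0 := by exact_mod_cast Real.pi_ne_zero
      simp [*]
    have : (fun t : ℝ => Complex.exp (2 * Real.pi * Complex.I * (((l : ℝ) / (2 * d) * t : ℝ) : ℂ)))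
        = fun t : ℝ => Complex.exp ((2 * Real.pi * Complex.I * ((l : ℂ) / (2 * d))) * t) := by
      ext t; push_cast; congr 1; ring
    rw [this, integral_exp_mul_complex hc]
    have e : (2 * Real.pi * Complex.I * ((l : ℂ) / (2 * d))) * (d : ℝ) =
        (2 * Real.pi * Complex.I * ((l : ℂ) / (2 * d))) * ((-d : ℝ) : ℂ) +
          l * (2 * Real.pi * Complex.I) := by
      push_cast; field_simp; ring
    rw [e, Complex.exp_periodic.int_mul l]
    simp

lemma inner_mode {m : ℕ} {d : ℝ} (hd : 0 < d) (k n : Fin m → ℤ) :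
    inner ℂ (mode d k : L2 m) (mode d n) = if k = n then (((2 * d) ^ m : ℝ) : ℂ) else 0 := by
  have h1 : inner ℂ (mode d k : L2 m) (mode d n) =
      ∫ x : RR m, ∏ j, (Set.Ioo (-d) d).indicator (fun t : ℝ => Complex.exp
        (2 * Real.pi * Complex.I * ((((n j - k j : ℤ) : ℝ) / (2 * d) * t : ℝ) : ℂ))) (x j) := by
    rw [L2.inner_def]
    refine integral_congr_ae ?_
    filter_upwards [(memLp_modeFun (m := m) d k).coeFn_toLp, (memLp_modeFun d n).coeFn_toLp]
      with x hk hn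
    rw [mode, mode, hk, hn]
    by_cases hx : x ∈ cube m d
    · have hx' : ∀ j, x j ∈ Set.Ioo (-d) d := hx
      simp only [modeFun, Set.indicator_of_mem hx, Set.indicator_of_mem (hx' _), RCLike.inner_apply]
      rw [← Complex.exp_conj, ← Complex.exp_add, ← Complex.exp_sum]
      congr 1
      simp only [phase, map_mul, Complex.conj_I, Complex.conj_ofReal, map_ofNat]
      rw [← Finset.mul_sum]
      push_cast
      have : ∑ j, ((n j : ℂ) - k j) / (2 * d) * (x j : ℂ) =
          ∑ j, (n j : ℂ) / (2 * d) * (x j : ℂ) - ∑ j, (k j : ℂ) / (2 * d) * (x j : ℂ) := by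
        rw [← Finset.sum_sub_distrib]; exact Finset.sum_congr rfl fun j _ => by ring
      rw [this]; ring
    · simp only [modeFun, Set.indicator_of_notMem hx, inner_zero_left]
      have : ∃ j, x j ∉ Set.Ioo (-d) d := by simpa [cube] using hx
      obtain ⟨j, hj⟩ := this
      exact (Finset.prod_eq_zero (Finset.mem_univ j) (Set.indicator_of_notMem hj _)).symm
  have h2 := (EuclideanSpace.volume_preserving_symm_measurableEquiv_toLp (Fin m)).integral_comp'
    (g := fun y : Fin m → ℝ => ∏ j, (Set.Ioo (-d) d).indicator (fun t : ℝ => Complex.exp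
        (2 * Real.pi * Complex.I * ((((n j - k j : ℤ) : ℝ) / (2 * d) * t : ℝ) : ℂ))) (y j))
  rw [h1]
  refine Eq.trans h2 ?_
  rw [integral_fintype_prod_volume_eq_prod (fun j => (Set.Ioo (-d) d).indicator (fun t : ℝ =>
    Complex.exp (2 * Real.pi * Complex.I * ((((n j - k j : ℤ) : ℝ) / (2 * d) * t : ℝ) : ℂ))))]
  simp only [integral_exp_period hd]
  split_ifs with h
  · subst h; simp
  · obtain ⟨j, hj⟩ := Function.ne_iff.mp h
    exact Finset.prod_eq_zero (Finset.mem_univ j) (if_neg (sub_ne_zero.mpr (Ne.symm hj)))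

lemma fourierSeries_eq_inner {m : ℕ} {d : ℝ} (hd : 0 < d) (u : L2 m) (n : Fin m → ℤ) :
    fourierSeries d u n = ((((2 * d) ^ m)⁻¹ : ℝ) : ℂ) * inner ℂ (mode d n) u := by
  have hv : volume.real (cube m d) = (2 * d) ^ m := by
    rw [measureReal_def, volume_cube, ENNReal.toReal_pow, ENNReal.toReal_ofReal (by linarith)]
  rw [fourierSeries, hv, L2.inner_def, ← integral_indicator (measurableSet_cube m d)]
  congr 1
  refine integral_congr_ae ?_
  filter_upwards [(memLp_modeFun (m := m) d n).coeFn_toLp] with x hx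
  rw [mode, hx]
  by_cases hc : x ∈ cube m d
  · simp only [modeFun, Set.indicator_of_mem hc, RCLike.inner_apply, ← Complex.exp_conj]
    congr 2
    simp only [phase, map_mul, Complex.conj_I, Complex.conj_ofReal, map_ofNat]
    ring
  · simp [modeFun, Set.indicator_of_notMem hc]

/-- For a bounded diagonal `k` the series that defines `periodicFun d k` converges in `L²`, and
`periodicFun d k` is a bounded linear map. -/
lemma isBoundedLinearMap_periodicFun {m : ℕ} {d : ℝ} (hd : 0 < d) {k : (Fin m → ℤ) → ℂ} {C : ℝ}
    (hk : ∀ n, ‖k n‖ ≤ C) :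
    (∀ u : L2 m, Summable fun n => (k n * fourierSeries d u n) • (mode d n : L2 m)) ∧
      IsBoundedLinearMap ℂ (periodicFun d k) := by
  set s : ℝ := Real.sqrt ((2 * d) ^ m) with hs
  have hs0 : 0 < s := Real.sqrt_pos.mpr (by positivity)
  have hss : s * s = (2 * d) ^ m := Real.mul_self_sqrt (by positivity)
  have hsC : (s : ℂ) ≠ 0 := by exact_mod_cast hs0.ne'
  have hssC : (s : ℂ) * s = (((2 * d) ^ m : ℝ) : ℂ) := by rw [← hss]; push_cast; rfl
  let e : (Fin m → ℤ) → L2 m := fun n => ((s⁻¹ : ℝ) : ℂ) • mode d n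
  have he : Orthonormal ℂ e := by
    rw [orthonormal_iff_ite]
    intro i j
    simp only [e, inner_smul_left, inner_smul_right, inner_mode hd, Complex.conj_ofReal]
    split_ifs
    · rw [← hssC]; push_cast; field_simp
    · simp
  have hterm : ∀ (u : L2 m) n, (k n * fourierSeries d u n) • (mode d n : L2 m) =
      (k n * inner ℂ (e n) u) • e n := by
    intro u n
    simp only [e, fourierSeries_eq_inner hd, inner_smul_left, Complex.conj_ofReal, smul_smul]
    congr 1
    rw [← hss]; push_cast; field_simp
  have hC : 0 ≤ C := (norm_nonneg _).trans (hk 0)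
  have hle : ∀ (u : L2 m) n, ‖k n * inner ℂ (e n) u‖ ^ 2 ≤ C ^ 2 * ‖inner ℂ (e n) u‖ ^ 2 := by
    intro u n
    rw [norm_mul, mul_pow]
    gcongr
    exact hk n
  have hsq : ∀ u : L2 m, Summable fun n => ‖k n * inner ℂ (e n) u‖ ^ 2 := fun u =>
    Summable.of_nonneg_of_le (fun _ => by positivity) (hle u)
      ((he.inner_products_summable u).mul_left _)
  have hV := he.orthogonalFamily
  have hsum : ∀ u : L2 m, Summable fun n => (k n * inner ℂ (e n) u) • e n := fun u => by
    simpa using (hV.summable_iff_norm_sq_summable fun n => k n * inner ℂ (e n) u).2 (hsq u)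
  have hsum' : ∀ u : L2 m, Summable fun n => (k n * fourierSeries d u n) • (mode d n : L2 m) :=
    fun u => by simpa only [hterm] using hsum u
  refine ⟨hsum', IsLinearMap.with_bound ⟨?_, ?_⟩ C ?_⟩
  · intro u w
    simp only [periodicFun, hterm]
    rw [← (hsum u).tsum_add (hsum w)]
    exact tsum_congr fun n => by rw [inner_add_right]; module
  · intro c u
    simp only [periodicFun, hterm]
    rw [← (hsum u).tsum_const_smul]
    exact tsum_congr fun n => by rw [inner_smul_right]; module
  · intro u
    simp only [periodicFun, hterm]
    have hmem : Memℓp (fun n => k n * inner ℂ (e n) u) 2 :=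
      memℓp_gen (by simpa using hsq u)
    let f : lp (fun _ : Fin m → ℤ => ℂ) 2 := ⟨_, hmem⟩
    have h1 : ∑' n, (k n * inner ℂ (e n) u) • e n = hV.linearIsometry f := by
      rw [hV.linearIsometry_apply]; simp [f]
    rw [h1, LinearIsometry.norm_map]
    refine abs_le_of_sq_le_sq' ?_ (by positivity) |>.2
    have h2 : ‖f‖ ^ 2 = ∑' n, ‖k n * inner ℂ (e n) u‖ ^ 2 := by
      have := lp.norm_rpow_eq_tsum (p := 2) (by norm_num) f
      simpa [f] using this
    rw [h2, mul_pow]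
    calc ∑' n, ‖k n * inner ℂ (e n) u‖ ^ 2 ≤ ∑' n, C ^ 2 * ‖inner ℂ (e n) u‖ ^ 2 :=
          (hsq u).tsum_le_tsum (hle u) ((he.inner_products_summable u).mul_left _)
      _ = C ^ 2 * ∑' n, ‖inner ℂ (e n) u‖ ^ 2 := tsum_mul_left
      _ ≤ C ^ 2 * ‖u‖ ^ 2 := by gcongr; exact he.tsum_inner_products_le u

/-- The bounded operator `K = 1_{Ω₀} K 1_{Ω₀}` of `L²(ℝ^m)` whose Fourier series representation
on `Ω₀` is the diagonal operator with the bounded sequence `k` on the diagonal. -/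
def periodicOp {m : ℕ} (d : ℝ) (k : (Fin m → ℤ) → ℂ) : L2 m →L[ℂ] L2 m :=
  open Classical in
  if h : IsBoundedLinearMap ℂ (periodicFun d k) then h.toContinuousLinearMap else 0

/-! ### The operators `∂^α 𝕃⁻¹`, `𝕂_α` and the two error bounds -/

/-- The symbol `(2πi ξ)^α / l(ξ)` of `∂^α 𝕃⁻¹`, where `l` is the symbol of `𝕃 = P(∂)`. -/
def resSymbol {m : ℕ} (P : MvPolynomial (Fin m) ℂ) (α : Fin m →₀ ℕ) (ξ : RR m) : ℂ :=
  dsymbol α ξ / symbol P ξ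

/-- The operator `∂^α 𝕃⁻¹` on `L²`. -/
def derivInv {m : ℕ} (P : MvPolynomial (Fin m) ℂ) (α : Fin m →₀ ℕ) : L2 m →L[ℂ] L2 m :=
  fourierMult (resSymbol P α)

/-- The operator `𝕂_α`, whose Fourier series representation on `Ω₀` is the adjoint of the
diagonal operator `∂^α L⁻¹ = diag ((2πi ñ)^α / l(ñ))`. -/
def Kop {m : ℕ} (P : MvPolynomial (Fin m) ℂ) (d : ℝ) (α : Fin m →₀ ℕ) : L2 m →L[ℂ] L2 m :=
  periodicOp d fun n => (starRingEnd ℂ) (resSymbol P α (tilde d n))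

/-- `((∂^α 𝕃⁻¹)^* - 𝕂_α) v^*`, where `v^*` is the adjoint of the multiplication by `v`. -/
def errorOp {m : ℕ} (P : MvPolynomial (Fin m) ℂ) (d : ℝ) (α : Fin m →₀ ℕ) (v : RR m → ℂ) :
    L2 m →L[ℂ] L2 m :=
  (ContinuousLinearMap.adjoint (derivInv P α) - Kop P d α).comp
    (ContinuousLinearMap.adjoint (mulOp v))

/-- `Z_{u,1}^α`: the operator norm of the error outside of `Ω₀`. -/
def Zu1 {m : ℕ} (P : MvPolynomial (Fin m) ℂ) (d : ℝ) (α : Fin m →₀ ℕ) (v : RR m → ℂ) : ℝ :=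
  ‖(indOp (cube m d)ᶜ).comp (errorOp P d α v)‖

/-- `Z_{u,2}^α`: the operator norm of the error on `Ω₀`. -/
def Zu2 {m : ℕ} (P : MvPolynomial (Fin m) ℂ) (d : ℝ) (α : Fin m →₀ ℕ) (v : RR m → ℂ) : ℝ :=
  ‖(indOp (cube m d)).comp (errorOp P d α v)‖

/-- The function `f_α` defined by `f̂_α(ξ) = (-2πi ξ)^α / l(-ξ)` satisfies
`|f_α(x)| ≤ C e^{-a |x|₁}` for all `x`. -/
def KernelBound {m : ℕ} (P : MvPolynomial (Fin m) ℂ) (α : Fin m →₀ ℕ) (a C : ℝ) : Prop :=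
  ∃ f : RR m → ℂ, AEStronglyMeasurable f (volume : Measure (RR m)) ∧
    (∀ ξ : RR m, 𝓕 f ξ = dsymbol α (-ξ) / symbol P (-ξ)) ∧
    ∀ x : RR m, ‖f x‖ ≤ C * Real.exp (-(a * ∑ i, |x i|))

/-- The function `e^{2ad} - e^{2ad} ∏_i (1 - e^{-2ad} cosh (2 a x_i))`. -/
def e1 {m : ℕ} (a d : ℝ) (x : RR m) : ℝ :=
  Real.exp (2 * a * d) - Real.exp (2 * a * d) *
    ∏ i, (1 - Real.exp (-(2 * a * d)) * Real.cosh (2 * a * x i))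

/-- The function `∏_i cosh (2 a x_i)`. -/
def e2 {m : ℕ} (a : ℝ) (x : RR m) : ℝ := ∏ i, Real.cosh (2 * a * x i)

/-- The Fourier series representation `E₁` of `e1` on `Ω₀`. -/
def E1 (m : ℕ) (a d : ℝ) : (Fin m → ℤ) → ℂ := fourierSeries d fun x : RR m => (e1 a d x : ℂ)

/-- The Fourier series representation `E₂` of `e2` on `Ω₀`. -/
def E2 (m : ℕ) (a d : ℝ) : (Fin m → ℤ) → ℂ := fourierSeries d fun x : RR m => (e2 a x : ℂ)

/-- The number `(V^*, V * E)₂` is well defined: the series of the convolution `V * E` and of the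
pairing converge absolutely, and the value is a nonnegative real number. -/
def PairingWellDefined {m : ℕ} (V E : (Fin m → ℤ) → ℂ) : Prop :=
  (∀ n, Summable fun k => V k * E (n - k)) ∧
  (Summable fun n => seqConj V n * seqConv V E n) ∧
  (seqPair (seqConj V) (seqConv V E)).im = 0 ∧ 0 ≤ (seqPair (seqConj V) (seqConv V E)).re

/-- The real number `(V^*, V * E)₂`. -/
def pairing {m : ℕ} (V E : (Fin m → ℤ) → ℂ) : ℝ := (seqPair (seqConj V) (seqConv V E)).re

end UnboundedPDE

end

noncomputable section

namespace UnboundedPDE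

/-! ### Operators on `L²` -/

section Operators

variable {m : ℕ}

/-! The operator `(∂^α 𝕃⁻¹)^*` is the convolution with `k = conj f_α`, since `𝓕 k` is the conjugate
of the symbol `(2πiξ)^α / l(ξ)`. For `u ∈ L²` put `g = conj(v_α) u`, which vanishes off the cube,
and `w = k * g`. The values `ŵ(ñ)/|Ω₀|` are the Fourier coefficients both of `𝕂_α g` and of the
periodization `∑_j w(x + 2dj)`. By completeness of the Fourier series, `𝕂_α g` is this periodization
on the cube. Hence the error is `w` outside of the cube and minus the sum of the translates with `j
≠ 0` on it (`errorOp_bounds`).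

Outside, Cauchy-Schwarz in `y` and Tonelli leave the integral of `e^{-2a|x-y|₁}` over the complement
of the cube, which is exactly `e^{-2ad} a^{-m} e1(y)` (`setIntegral_compl_cube_exp`). Parseval's
identity turns `∫_{Ω₀} |v_α|² e1` into `|Ω₀| (V^*, V * E₁)₂` (`pairing_eq`).

Inside, the squared sum of translates is expanded (`lintegral_cube_shiftSum_sq_le`). The diagonal
terms tile the complement of the cube and reproduce the outer error. A product of two different
nontrivial translates decays like `e^{-2ad c}` with an integer `c ≥ 2` (`crossSum_le_dist`,
`two_le_crossSum`), at the cost of weights `e^{a|y|₁}`, which a second Cauchy-Schwarz inequality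
turns into `e2`. This gives the factor `e^{-4ad}`. The lattice sum that remains is at most a
constant times a rational function of `d` (`crossTotal_le`).

These arguments need `v_α` continuous, bounded and zero off the cube. Continuity holds because each
`g û₀ = (g/l)(l û₀)` is integrable. The support property holds because differential operators are
local (`diffOp_ae_eq_zero`) and every product in `v_α` has at least one factor. For the decay in
`d`, the support of `v_α` stays in a fixed cube, where `e1` and `e2` are bounded independently of
`d`, and a factor `e^{-2ad}` absorbs the power of `d` in the rational function. -/

lemma mulOp_coeFn {g : RR m → ℂ} (hg : MemLp g ∞ (volume : Measure (RR m))) (u : L2 m) :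
    mulOp g u =ᵐ[volume] fun x => g x * u x := by
  rw [mulOp, dif_pos hg]
  have h := ContinuousLinearMap.coeFn_holder (r := 2) (ContinuousLinearMap.mul ℂ ℂ)
    (hg.toLp g) u
  filter_upwards [h, hg.coeFn_toLp] with x h1 h2
  rw [ContinuousLinearMap.holderL_apply_apply, h1, h2]
  rfl

lemma memLp_top_indicator (s : Set (RR m)) (hs : MeasurableSet s) :
    MemLp (s.indicator fun _ => (1 : ℂ)) ∞ (volume : Measure (RR m)) := by
  refine memLp_top_of_bound ((aestronglyMeasurable_const).indicator hs) 1 (.of_forall fun x => ?_)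
  by_cases hx : x ∈ s <;> simp [hx]

lemma indOp_coeFn {s : Set (RR m)} (hs : MeasurableSet s) (u : L2 m) :
    indOp s u =ᵐ[volume] s.indicator u := by
  filter_upwards [mulOp_coeFn (memLp_top_indicator s hs) u] with x hx
  rw [indOp, hx]
  by_cases h : x ∈ s <;> simp [h]

lemma adjoint_mulOp {g : RR m → ℂ} (hg : MemLp g ∞ (volume : Measure (RR m))) :
    ContinuousLinearMap.adjoint (mulOp g) = mulOp fun x => (starRingEnd ℂ) (g x) := by
  have hg' : MemLp (fun x => (starRingEnd ℂ) (g x)) ∞ (volume : Measure (RR m)) := hg.star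
  symm
  rw [ContinuousLinearMap.eq_adjoint_iff]
  intro u w
  rw [L2.inner_def, L2.inner_def]
  refine integral_congr_ae ?_
  filter_upwards [mulOp_coeFn hg w, mulOp_coeFn hg' u] with x h1 h2
  simp only [h1, h2, RCLike.inner_apply, map_mul, Complex.conj_conj]
  ring

lemma adjoint_fourierCLM : ContinuousLinearMap.adjoint (fourierCLM m) = fourierInvCLM m := by
  symm
  rw [ContinuousLinearMap.eq_adjoint_iff]
  intro u w
  have := (Lp.fourierTransformₗᵢ (RR m) ℂ).inner_map_map
    ((Lp.fourierTransformₗᵢ (RR m) ℂ).symm u) w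
  rw [LinearIsometryEquiv.apply_symm_apply] at this
  exact this.symm

lemma adjoint_fourierMult {σ : RR m → ℂ} (hσ : MemLp σ ∞ (volume : Measure (RR m))) :
    ContinuousLinearMap.adjoint (fourierMult σ) = fourierMult fun x => (starRingEnd ℂ) (σ x) := by
  rw [fourierMult, ContinuousLinearMap.adjoint_comp, ContinuousLinearMap.adjoint_comp,
    adjoint_mulOp hσ, ← adjoint_fourierCLM, ContinuousLinearMap.adjoint_adjoint,
    adjoint_fourierCLM, fourierMult, ContinuousLinearMap.comp_assoc]

lemma fourier_fourierMult {σ : RR m → ℂ} (hσ : MemLp σ ∞ (volume : Measure (RR m))) (u : L2 m) :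
    (𝓕 (fourierMult σ u) : L2 m) =ᵐ[volume] fun ξ => σ ξ * (𝓕 u : L2 m) ξ := by
  have : (𝓕 (fourierMult σ u) : L2 m) = mulOp σ (𝓕 u : L2 m) :=
    (Lp.fourierTransformₗᵢ (RR m) ℂ).apply_symm_apply _
  rw [this]
  exact mulOp_coeFn hσ _

/-- Self-duality of the Fourier transform, read off from the compatibility of the `L²` transform
with that of tempered distributions. -/
lemma integral_fourier_mul_schwartz (u : L2 m) (φ : SchwartzMap (RR m) ℂ) :
    ∫ x, φ x * (𝓕 u : L2 m) x = ∫ x, (𝓕 φ : SchwartzMap (RR m) ℂ) x * u x := by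
  have h := congrArg (fun T => T φ) (Lp.fourier_toTemperedDistribution_eq u)
  simp only [TemperedDistribution.fourier_apply, Lp.toTemperedDistribution_apply] at h
  simpa [smul_eq_mul] using h.symm

/-- For an integrable function in `L²` the `L²` Fourier transform is the Fourier integral. -/
lemma fourier_toLp_of_integrable {g : RR m → ℂ} (h1 : Integrable g)
    (h2 : MemLp g 2 (volume : Measure (RR m))) :
    (𝓕 (h2.toLp g) : L2 m) =ᵐ[volume] 𝓕 g := by
  have hcont : Continuous (𝓕 g) :=
    VectorFourier.fourierIntegral_continuous Real.continuous_fourierChar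
      (by exact continuous_inner) h1
  -- Both transforms are tested against smooth compactly supported functions. Each pairing equals
  -- the integral of `g` against the transform of the test function.
  refine ae_eq_of_integral_contDiff_smul_eq
    ((Lp.memLp (𝓕 (h2.toLp g) : L2 m)).locallyIntegrable (by norm_num))
    hcont.locallyIntegrable fun φ hφ hφc => ?_
  have hc : HasCompactSupport fun x => ((φ x : ℝ) : ℂ) := hφc.comp_left Complex.ofReal_zero
  let ψ : SchwartzMap (RR m) ℂ := hc.toSchwartzMap (Complex.ofRealCLM.contDiff.comp hφ)
  have hψ : ∀ x, ψ x = φ x := fun x => rfl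
  have e1 := integral_fourier_mul_schwartz (h2.toLp g) ψ
  have e2 : ∫ x, 𝓕 g x • ψ x = ∫ x, g x • 𝓕 (ψ : RR m → ℂ) x := by
    have := VectorFourier.integral_fourierIntegral_smul_eq_flip (μ := volume) (ν := volume)
      (L := innerₗ (RR m)) Real.continuous_fourierChar (by exact continuous_inner) h1 ψ.integrable
    rw [flip_innerₗ] at this
    exact this
  calc ∫ x, φ x • (𝓕 (h2.toLp g) : L2 m) x = ∫ x, ψ x * (𝓕 (h2.toLp g) : L2 m) x := by
        simp [hψ]
    _ = ∫ x, (𝓕 ψ : SchwartzMap (RR m) ℂ) x * (h2.toLp g) x := e1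
    _ = ∫ x, g x • 𝓕 (ψ : RR m → ℂ) x := by
        refine integral_congr_ae ?_
        filter_upwards [h2.coeFn_toLp] with x hx
        rw [hx, SchwartzMap.fourier_coe, smul_eq_mul, mul_comm]
    _ = ∫ x, φ x • 𝓕 g x := by
        rw [← e2]
        refine integral_congr_ae (.of_forall fun x => ?_)
        simp [hψ, mul_comm]

end Operators

/-! ### The convolution kernel of `(∂^α 𝕃⁻¹)^*` -/

section Kernel

variable {m : ℕ}

lemma memLp_two_of_integrable_of_bound {g : RR m → ℂ} {C : ℝ} (h1 : Integrable g)
    (hC : ∀ x, ‖g x‖ ≤ C) : MemLp g 2 (volume : Measure (RR m)) := by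
  rw [memLp_two_iff_integrable_sq_norm h1.1]
  refine (h1.norm.const_mul C).mono' (h1.1.norm.pow 2) (.of_forall fun x => ?_)
  rw [Real.norm_of_nonneg (by positivity), sq]
  exact mul_le_mul_of_nonneg_right (hC x) (norm_nonneg _)

/-- The convolution `∫ k(x - y) g(y) dy`. -/
def convFun (k g : RR m → ℂ) (x : RR m) : ℂ := ∫ y, k (x - y) * g y

lemma convFun_eq_convolution (k g : RR m → ℂ) :
    convFun k g = convolution g k (ContinuousLinearMap.mul ℂ ℂ) volume := by
  ext x
  simp only [convFun, convolution, ContinuousLinearMap.mul_apply']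
  exact integral_congr_ae (.of_forall fun y => mul_comm _ _)

lemma integrable_convFun {k g : RR m → ℂ} (hk : Integrable k) (hg : Integrable g) :
    Integrable (convFun k g) := by
  rw [convFun_eq_convolution]
  exact hg.integrable_convolution _ hk

lemma norm_convFun_le {k g : RR m → ℂ} {C : ℝ} (hC : ∀ x, ‖k x‖ ≤ C) (hg : Integrable g)
    (x : RR m) : ‖convFun k g x‖ ≤ C * ∫ y, ‖g y‖ := by
  rw [convFun, ← integral_const_mul]
  refine norm_integral_le_of_norm_le (hg.norm.const_mul C) (.of_forall fun y => ?_)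
  rw [norm_mul]
  exact mul_le_mul_of_nonneg_right (hC _) (norm_nonneg _)

lemma memLp_convFun {k g : RR m → ℂ} {C : ℝ} (hk : Integrable k) (hC : ∀ x, ‖k x‖ ≤ C)
    (hg : Integrable g) : MemLp (convFun k g) 2 (volume : Measure (RR m)) :=
  memLp_two_of_integrable_of_bound (integrable_convFun hk hg) (norm_convFun_le hC hg)

lemma fourier_convFun {k g : RR m → ℂ} (hk : Integrable k) (hg : Integrable g) (ξ : RR m) :
    𝓕 (convFun k g) ξ = 𝓕 k ξ * 𝓕 g ξ := by
  rw [convFun_eq_convolution, Real.fourier_mul_convolution_eq hg hk, mul_comm]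

lemma fourier_conj (f : RR m → ℂ) (ξ : RR m) :
    𝓕 (fun x => (starRingEnd ℂ) (f x)) ξ = (starRingEnd ℂ) (𝓕 f (-ξ)) := by
  rw [Real.fourier_eq', Real.fourier_eq', ← integral_conj]
  refine integral_congr_ae (.of_forall fun x => ?_)
  simp only [smul_eq_mul, map_mul, ← Complex.exp_conj, Complex.conj_I, Complex.conj_ofReal,
    inner_neg_right]
  congr 2
  push_cast
  ring

/-- A Fourier multiplier whose symbol is the Fourier transform of an integrable bounded function
is the convolution with that function. -/
lemma fourierMult_toLp {k g : RR m → ℂ} {C : ℝ} (hk : Integrable k) (hC : ∀ x, ‖k x‖ ≤ C)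
    (hg : Integrable g) (hg2 : MemLp g 2 (volume : Measure (RR m)))
    (hσ : MemLp (𝓕 k) ∞ (volume : Measure (RR m))) :
    fourierMult (𝓕 k) (hg2.toLp g) = (memLp_convFun hk hC hg).toLp (convFun k g) := by
  apply (Lp.fourierTransformₗᵢ (RR m) ℂ).injective
  change (𝓕 (fourierMult (𝓕 k) (hg2.toLp g)) : L2 m) =
    (𝓕 ((memLp_convFun hk hC hg).toLp (convFun k g)) : L2 m)
  refine Lp.ext ?_
  filter_upwards [fourier_fourierMult hσ (hg2.toLp g), fourier_toLp_of_integrable hg hg2,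
    fourier_toLp_of_integrable (integrable_convFun hk hg) (memLp_convFun hk hC hg)] with ξ h1 h2 h3
  rw [h1, h2, h3, fourier_convFun hk hg]

end Kernel

/-! ### One-dimensional and product integrals -/

section Integrals

lemma integrable_exp_neg_mul_abs {b : ℝ} (hb : 0 < b) (y : ℝ) :
    Integrable (fun t : ℝ => Real.exp (-(b * |t - y|))) := by
  suffices h : Integrable (fun t : ℝ => Real.exp (-(b * |t|))) from h.comp_sub_right y
  have h1 : IntegrableOn (fun t : ℝ => Real.exp (-(b * |t|))) (Set.Ioi 0) := by
    refine (exp_neg_integrableOn_Ioi 0 hb).congr_fun (fun t ht => ?_) measurableSet_Ioi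
    simp [abs_of_pos (Set.mem_Ioi.1 ht)]
  have h2 : IntegrableOn (fun t : ℝ => Real.exp (-(b * |t|))) (Set.Iic 0) := by
    have := ((integrableOn_Ici_iff_integrableOn_Ioi (by simp)).2 h1).comp_neg
    simpa using this
  rw [← integrableOn_univ, ← Set.Iic_union_Ioi (a := (0 : ℝ))]
  exact h2.union h1

lemma hasDerivAt_exp_mul {b : ℝ} (hb : b ≠ 0) (y t : ℝ) :
    HasDerivAt (fun s : ℝ => Real.exp (b * (s - y)) / b) (Real.exp (b * (t - y))) t := by
  have := ((((hasDerivAt_id t).sub_const y).const_mul b).exp).div_const b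
  convert! this using 1
  simp; field_simp

/-- Splitting at the kink `t = y` gives two boundary terms `e^{-b(d+y)}` and `e^{-b(d-y)}`, whose
sum is `2 e^{-bd} cosh(by)`. This is the origin of the hyperbolic cosines in the weights. -/
lemma integral_exp_neg_mul_abs_Ioo {b : ℝ} (hb : 0 < b) {d y : ℝ} (h1 : -d ≤ y) (h2 : y ≤ d) :
    ∫ t in Set.Ioo (-d) d, Real.exp (-(b * |t - y|)) =
      2 / b * (1 - Real.exp (-(b * d)) * Real.cosh (b * y)) := by
  rw [← integral_Ioc_eq_integral_Ioo, ← intervalIntegral.integral_of_le (h1.trans h2)]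
  have hi : ∀ u v : ℝ, IntervalIntegrable (fun t : ℝ => Real.exp (-(b * |t - y|))) volume u v :=
    fun u v => (by fun_prop : Continuous fun t : ℝ => Real.exp (-(b * |t - y|))).intervalIntegrable
      u v
  rw [← intervalIntegral.integral_add_adjacent_intervals (hi (-d) y) (hi y d)]
  have e1 : ∫ t in (-d)..y, Real.exp (-(b * |t - y|)) = (1 - Real.exp (b * (-d - y))) / b := by
    rw [intervalIntegral.integral_congr (g := fun t => Real.exp (b * (t - y)))]
    · rw [intervalIntegral.integral_eq_sub_of_hasDerivAt
        (fun t _ => hasDerivAt_exp_mul hb.ne' y t)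
        ((by fun_prop : Continuous fun t : ℝ => Real.exp (b * (t - y))).intervalIntegrable _ _)]
      simp; ring
    · intro t ht
      rw [Set.uIcc_of_le h1] at ht
      simp only
      rw [abs_of_nonpos (by linarith [ht.2])]
      congr 1; ring
  have e2 : ∫ t in y..d, Real.exp (-(b * |t - y|)) = (1 - Real.exp (-b * (d - y))) / b := by
    rw [intervalIntegral.integral_congr (g := fun t => Real.exp (-b * (t - y)))]
    · rw [intervalIntegral.integral_eq_sub_of_hasDerivAt
        (fun t _ => hasDerivAt_exp_mul (neg_ne_zero.2 hb.ne') y t)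
        ((by fun_prop : Continuous fun t : ℝ => Real.exp (-b * (t - y))).intervalIntegrable _ _)]
      simp; field_simp; ring
    · intro t ht
      rw [Set.uIcc_of_le h2] at ht
      simp only
      rw [abs_of_nonneg (by linarith [ht.1])]
      congr 1; ring
  rw [e1, e2, Real.cosh_eq]
  have f1 : Real.exp (b * (-d - y)) = Real.exp (-(b * d)) * Real.exp (-(b * y)) := by
    rw [← Real.exp_add]; ring_nf
  have f2 : Real.exp (-b * (d - y)) = Real.exp (-(b * d)) * Real.exp (b * y) := by
    rw [← Real.exp_add]; ring_nf
  rw [f1, f2]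
  field_simp
  ring

lemma integral_exp_neg_mul_abs {b : ℝ} (hb : 0 < b) (y : ℝ) :
    ∫ t : ℝ, Real.exp (-(b * |t - y|)) = 2 / b := by
  rw [integral_sub_right_eq_self (fun t : ℝ => Real.exp (-(b * |t|))) y,
    integral_comp_abs (f := fun t : ℝ => Real.exp (-(b * t)))]
  have := integral_exp_mul_Ioi (a := -b) (by linarith) 0
  simp only [neg_mul] at this
  rw [this]
  simp
  field_simp

variable {m : ℕ}

lemma integral_prod_coord (f : Fin m → ℝ → ℝ) :
    ∫ x : RR m, ∏ i, f i (x i) = ∏ i, ∫ t, f i t := by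
  rw [← integral_fintype_prod_volume_eq_prod]
  exact (EuclideanSpace.volume_preserving_symm_measurableEquiv_toLp (Fin m)).integral_comp'
    (g := fun y : Fin m → ℝ => ∏ j, f j (y j))

lemma integrable_prod_coord {f : Fin m → ℝ → ℝ} (hf : ∀ i, Integrable (f i)) :
    Integrable fun x : RR m => ∏ i, f i (x i) := by
  have := (EuclideanSpace.volume_preserving_symm_measurableEquiv_toLp
    (Fin m)).integrable_comp_of_integrable (Integrable.fintype_prod (μ := fun _ => (volume : Measure ℝ)) hf)
  exact this

lemma exp_neg_mul_sum (b : ℝ) (x : Fin m → ℝ) :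
    Real.exp (-(b * ∑ i, |x i|)) = ∏ i, Real.exp (-(b * |x i|)) := by
  rw [← Real.exp_sum, Finset.mul_sum, Finset.sum_neg_distrib]

lemma integrable_exp_neg_mul_sum {b : ℝ} (hb : 0 < b) (y : RR m) :
    Integrable fun x : RR m => Real.exp (-(b * ∑ i, |x i - y i|)) := by
  have := integrable_prod_coord (m := m) (fun i => integrable_exp_neg_mul_abs hb (y i))
  refine this.congr (.of_forall fun x => ?_)
  exact (exp_neg_mul_sum b fun i => x i - y i).symm

lemma integral_exp_neg_mul_sum {b : ℝ} (hb : 0 < b) (y : RR m) :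
    ∫ x : RR m, Real.exp (-(b * ∑ i, |x i - y i|)) = (2 / b) ^ m := by
  have := integral_prod_coord (m := m) (fun i t => Real.exp (-(b * |t - y i|)))
  simp only [integral_exp_neg_mul_abs hb, Finset.prod_const, Finset.card_univ,
    Fintype.card_fin] at this
  rw [← this]
  exact integral_congr_ae (.of_forall fun x => exp_neg_mul_sum b fun i => x i - y i)

/-- The `ℓ¹` norm in the exponent makes both the integrand and the indicator of the cube products
over the coordinates. -/
lemma setIntegral_cube_exp_neg_mul_sum {b : ℝ} (hb : 0 < b) {d : ℝ} {y : RR m}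
    (hy : y ∈ cube m d) :
    ∫ x in cube m d, Real.exp (-(b * ∑ i, |x i - y i|)) =
      (2 / b) ^ m * ∏ i, (1 - Real.exp (-(b * d)) * Real.cosh (b * y i)) := by
  have := integral_prod_coord (m := m)
    (fun i => (Set.Ioo (-d) d).indicator fun t => Real.exp (-(b * |t - y i|)))
  simp only [integral_indicator measurableSet_Ioo,
    integral_exp_neg_mul_abs_Ioo hb (hy _).1.le (hy _).2.le] at this
  rw [Finset.prod_mul_distrib, Finset.prod_const, Finset.card_univ, Fintype.card_fin] at this
  rw [← this, ← integral_indicator (measurableSet_cube m d)]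
  refine integral_congr_ae (.of_forall fun x => ?_)
  simp only
  by_cases hx : x ∈ cube m d
  · have hx' : ∀ i, x i ∈ Set.Ioo (-d) d := hx
    simp only [Set.indicator_of_mem hx, Set.indicator_of_mem (hx' _)]
    exact exp_neg_mul_sum b fun i => x i - y i
  · rw [Set.indicator_of_notMem hx]
    have : ∃ j, x j ∉ Set.Ioo (-d) d := by simpa [cube] using hx
    obtain ⟨j, hj⟩ := this
    exact (Finset.prod_eq_zero (Finset.mem_univ j) (Set.indicator_of_notMem hj _)).symm

/-- The mass outside of the cube of the squared kernel. -/
lemma setIntegral_compl_cube_exp {a : ℝ} (ha : 0 < a) {d : ℝ} {y : RR m} (hy : y ∈ cube m d) :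
    ∫ x in (cube m d)ᶜ, Real.exp (-(2 * a * ∑ i, |x i - y i|)) =
      Real.exp (-(2 * a * d)) / a ^ m * e1 a d y := by
  have h := integral_add_compl (measurableSet_cube m d)
    (integrable_exp_neg_mul_sum (m := m) (b := 2 * a) (by positivity) y)
  rw [integral_exp_neg_mul_sum (by positivity),
    setIntegral_cube_exp_neg_mul_sum (by positivity) hy] at h
  have h2 : (2 / (2 * a)) ^ m = 1 / a ^ m := by
    rw [← one_div_pow]; congr 1; field_simp
  rw [h2] at h
  have h3 : Real.exp (-(2 * a * d)) * Real.exp (2 * a * d) = 1 := by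
    rw [← Real.exp_add]; simp
  have ham : a ^ m ≠ 0 := by positivity
  rw [e1]
  set p := ∏ i, (1 - Real.exp (-(2 * a * d)) * Real.cosh (2 * a * y i))
  have : Real.exp (-(2 * a * d)) / a ^ m * (Real.exp (2 * a * d) - Real.exp (2 * a * d) * p) =
      (Real.exp (-(2 * a * d)) * Real.exp (2 * a * d)) / a ^ m * (1 - p) := by ring
  rw [this, h3]
  linear_combination h

end Integrals

/-! ### The weights `e1` and `e2` on the cube -/

section Weights

variable {m : ℕ}

/-- Puts the factors `1 - e^{-2ad} cosh(2a y_i)` of `e1` in `[0, 1]` on the cube, which gives the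
sign of `e1` and the hypothesis of the product inequality below. -/
lemma exp_mul_cosh_le_one {a d y : ℝ} (ha : 0 < a) (h : |y| ≤ d) :
    Real.exp (-(2 * a * d)) * Real.cosh (2 * a * y) ≤ 1 := by
  have h1 : Real.cosh (2 * a * y) ≤ Real.exp (2 * a * d) := by
    rw [← Real.cosh_abs, abs_mul, abs_of_pos (by positivity : 0 < 2 * a)]
    refine le_trans ?_ (Real.exp_le_exp.2 (mul_le_mul_of_nonneg_left h (by positivity)))
    rw [Real.cosh_eq]
    have : Real.exp (-(2 * a * |y|)) ≤ Real.exp (2 * a * |y|) :=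
      Real.exp_le_exp.2 (by have := abs_nonneg y; nlinarith)
    linarith
  calc _ ≤ Real.exp (-(2 * a * d)) * Real.exp (2 * a * d) := by gcongr
    _ = 1 := by rw [← Real.exp_add]; simp

lemma abs_lt_of_mem_cube {d : ℝ} {y : RR m} (hy : y ∈ cube m d) (i : Fin m) : |y i| < d :=
  abs_lt.2 (hy i)

lemma e1_nonneg {a d : ℝ} (ha : 0 < a) {y : RR m} (hy : y ∈ cube m d) : 0 ≤ e1 a d y := by
  have : ∏ i, (1 - Real.exp (-(2 * a * d)) * Real.cosh (2 * a * y i)) ≤ 1 :=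
    Finset.prod_le_one
      (fun i _ => sub_nonneg.2 (exp_mul_cosh_le_one ha (abs_lt_of_mem_cube hy i).le))
      fun _ _ => sub_le_self _ (mul_nonneg (Real.exp_nonneg _) (Real.cosh_pos _).le)
  rw [e1, ← mul_one_sub]
  exact mul_nonneg (Real.exp_nonneg _) (by linarith)

lemma e2_pos (a : ℝ) (y : RR m) : 0 < e2 a y := Finset.prod_pos fun _ _ => Real.cosh_pos _

/-- The Weierstrass product inequality. It linearizes the product in `e1`, so that the prefactor
`e^{2ad}` cancels against the `e^{-2ad}` of each factor. -/
lemma one_sub_sum_le_prod (s : Finset (Fin m)) (t : Fin m → ℝ) (h0 : ∀ i, 0 ≤ t i)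
    (h1 : ∀ i, t i ≤ 1) : 1 - ∑ i ∈ s, t i ≤ ∏ i ∈ s, (1 - t i) := by
  induction s using Finset.cons_induction with
  | empty => simp
  | cons i s hi ih =>
    rw [Finset.sum_cons, Finset.prod_cons]
    have hs : 0 ≤ ∑ i ∈ s, t i := Finset.sum_nonneg fun j _ => h0 j
    have := mul_le_mul_of_nonneg_left ih (sub_nonneg.2 (h1 i))
    nlinarith [mul_nonneg (h0 i) hs]

/-- The bound is uniform in `d ≥ d₀` although `e1` contains `e^{2ad}`; the decay statement rests on
this uniformity. The case `d₀ = d` supplies integrability. -/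
lemma e1_le {a d₀ d : ℝ} (ha : 0 < a) (hd : d₀ ≤ d) {y : RR m} (hy : y ∈ cube m d₀) :
    e1 a d y ≤ m * Real.cosh (2 * a * d₀) := by
  have hy' : ∀ i, |y i| ≤ d := fun i => (abs_lt_of_mem_cube hy i).le.trans hd
  have h := one_sub_sum_le_prod Finset.univ
    (fun i => Real.exp (-(2 * a * d)) * Real.cosh (2 * a * y i))
    (fun i => mul_nonneg (Real.exp_nonneg _) (Real.cosh_pos _).le)
    fun i => exp_mul_cosh_le_one ha (hy' i)
  have h3 : Real.exp (2 * a * d) * Real.exp (-(2 * a * d)) = 1 := by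
    rw [← Real.exp_add]; simp
  calc e1 a d y ≤ Real.exp (2 * a * d) *
        ∑ i, Real.exp (-(2 * a * d)) * Real.cosh (2 * a * y i) := by
        rw [e1, ← mul_one_sub]
        gcongr
        linarith
    _ = ∑ i, Real.cosh (2 * a * y i) := by
        rw [← Finset.mul_sum, ← mul_assoc, h3, one_mul]
    _ ≤ ∑ _i : Fin m, Real.cosh (2 * a * d₀) := by
        refine Finset.sum_le_sum fun i _ => Real.cosh_le_cosh.2 ?_
        have := (abs_lt_of_mem_cube hy i).le
        rw [abs_mul (2 * a), abs_mul (2 * a) d₀]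
        exact mul_le_mul_of_nonneg_left (this.trans (le_abs_self _)) (abs_nonneg _)
    _ = _ := by simp

lemma e2_le {a d₀ : ℝ} {y : RR m} (hy : y ∈ cube m d₀) :
    e2 a y ≤ Real.cosh (2 * a * d₀) ^ m := by
  calc e2 a y ≤ ∏ _i : Fin m, Real.cosh (2 * a * d₀) := by
        refine Finset.prod_le_prod (fun i _ => (Real.cosh_pos _).le)
          fun i _ => Real.cosh_le_cosh.2 ?_
        rw [abs_mul (2 * a), abs_mul (2 * a) d₀]
        exact mul_le_mul_of_nonneg_left ((abs_lt_of_mem_cube hy i).le.trans (le_abs_self _))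
          (abs_nonneg _)
    _ = _ := by simp

lemma continuous_e1 (a d : ℝ) : Continuous (e1 a d : RR m → ℝ) := by
  unfold e1; fun_prop

lemma continuous_e2 (a : ℝ) : Continuous (e2 a : RR m → ℝ) := by
  unfold e2; fun_prop

end Weights

/-! ### The coefficients `v_α` -/

section Coefficients

variable {m : ℕ}

lemma continuous_symbol (P : MvPolynomial (Fin m) ℂ) : Continuous (symbol P : RR m → ℂ) :=
  (MvPolynomial.continuous_eval P).comp (by fun_prop)

lemma continuous_dsymbol (α : Fin m →₀ ℕ) : Continuous (dsymbol α : RR m → ℂ) := by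
  unfold dsymbol; fun_prop

lemma symbol_eq_sum (P : MvPolynomial (Fin m) ℂ) (ξ : RR m) :
    symbol P ξ = ∑ β ∈ P.support, P.coeff β * dsymbol β ξ :=
  MvPolynomial.eval_eq' _ _

lemma KernelBound.nonneg {P : MvPolynomial (Fin m) ℂ} {α : Fin m →₀ ℕ} {a C : ℝ}
    (h : KernelBound P α a C) : 0 ≤ C := by
  obtain ⟨f, -, -, hf⟩ := h
  exact nonneg_of_mul_nonneg_left ((norm_nonneg _).trans (hf 0)) (Real.exp_pos _)

/-- The kernel of the adjoint of `∂^α 𝕃⁻¹`. -/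
lemma KernelBound.exists_kernel {P : MvPolynomial (Fin m) ℂ} {α : Fin m →₀ ℕ} {a C : ℝ}
    (ha : 0 < a) (h : KernelBound P α a C) :
    ∃ k : RR m → ℂ, Integrable k ∧ (∀ x, ‖k x‖ ≤ C * Real.exp (-(a * ∑ i, |x i|))) ∧
      𝓕 k = fun ξ => (starRingEnd ℂ) (resSymbol P α ξ) := by
  obtain ⟨f, hm, hF, hf⟩ := h
  refine ⟨fun x => (starRingEnd ℂ) (f x), ?_, fun x => by simpa using hf x, ?_⟩
  · have := (integrable_exp_neg_mul_sum (m := m) ha 0).const_mul C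
    refine this.mono' hm.star (.of_forall fun x => ?_)
    simpa using hf x
  · funext ξ
    rw [fourier_conj, hF, neg_neg, resSymbol]

lemma norm_le_const_of_kernel {k : RR m → ℂ} {a C : ℝ} (ha : 0 < a) (hC : 0 ≤ C)
    (hk : ∀ x, ‖k x‖ ≤ C * Real.exp (-(a * ∑ i, |x i|))) (x : RR m) : ‖k x‖ ≤ C :=
  (hk x).trans (mul_le_of_le_one_right hC (Real.exp_le_one_iff.2
    (neg_nonpos.2 (mul_nonneg ha.le (Finset.sum_nonneg fun _ _ => abs_nonneg _)))))

/-- The conjugated symbol is the Fourier transform of an integrable function, hence bounded by its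
`L¹` norm. -/
lemma KernelBound.exists_bound {P : MvPolynomial (Fin m) ℂ} {α : Fin m →₀ ℕ} {a C : ℝ}
    (ha : 0 < a) (h : KernelBound P α a C) : ∃ B, ∀ ξ, ‖resSymbol P α ξ‖ ≤ B := by
  obtain ⟨k, -, -, hF⟩ := h.exists_kernel ha
  refine ⟨∫ x, ‖k x‖, fun ξ => ?_⟩
  rw [← RCLike.norm_conj, ← congrFun hF ξ]
  exact VectorFourier.norm_fourierIntegral_le_integral_norm _ _ _ _ _

lemma memLp_resSymbol {P : MvPolynomial (Fin m) ℂ} {α : Fin m →₀ ℕ} {a C : ℝ}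
    (ha : 0 < a) (hP : ∀ ξ : RR m, symbol P ξ ≠ 0) (h : KernelBound P α a C) :
    MemLp (resSymbol P α) ∞ (volume : Measure (RR m)) := by
  obtain ⟨B, hB⟩ := h.exists_bound ha
  exact memLp_top_of_bound
    ((continuous_dsymbol α).div (continuous_symbol P) hP).aestronglyMeasurable B (.of_forall hB)

lemma exists_bound_symbol_div {P Q : MvPolynomial (Fin m) ℂ} {a : ℝ} {Cα : (Fin m →₀ ℕ) → ℝ}
    (ha : 0 < a) (h : ∀ β ∈ Q.support, KernelBound P β a (Cα β)) :
    ∃ B, ∀ ξ : RR m, ‖symbol Q ξ / symbol P ξ‖ ≤ B := by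
  -- The membership hypothesis is moved inside the existential, with `0` as the bound off the
  -- support, so that `choose` yields a bound for every `β`.
  have h' : ∀ β : Fin m →₀ ℕ, ∃ B, β ∈ Q.support → ∀ ξ, ‖resSymbol P β ξ‖ ≤ B := fun β => by
    by_cases hβ : β ∈ Q.support
    · exact ((h β hβ).exists_bound ha).imp fun B hB _ => hB
    · exact ⟨0, fun h => absurd h hβ⟩
  choose B hB using h'
  refine ⟨∑ β ∈ Q.support, ‖Q.coeff β‖ * B β, fun ξ => ?_⟩
  rw [symbol_eq_sum, Finset.sum_div]
  refine (norm_sum_le _ _).trans (Finset.sum_le_sum fun β hβ => ?_)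
  rw [mul_div_assoc, norm_mul]
  exact mul_le_mul_of_nonneg_left (hB β hβ ξ) (norm_nonneg _)

/-- The function `g û` is integrable, where `g` is the symbol of an operator dominated by `𝕃`. -/
lemma integrable_symbol_mul_fourier {P Q : MvPolynomial (Fin m) ℂ} {u : L2 m}
    (hP : ∀ ξ : RR m, symbol P ξ ≠ 0)
    (hQ : Integrable fun ξ : RR m => symbol Q ξ / symbol P ξ)
    (hB : ∃ B, ∀ ξ : RR m, ‖symbol Q ξ / symbol P ξ‖ ≤ B) (hu : MemHl P u) :
    Integrable fun ξ : RR m => symbol Q ξ * (𝓕 u : L2 m) ξ := by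
  obtain ⟨B, hB⟩ := hB
  -- Being bounded and integrable, `g/l` lies in `L²`, and `g û = (g/l)(l û)` is a product of two
  -- `L²` functions.
  have h2 := memLp_two_of_integrable_of_bound hQ hB
  refine (h2.integrable_mul hu).congr (.of_forall fun ξ => ?_)
  simp only [Pi.mul_apply]
  field_simp [hP ξ]

/-- Multiplying `𝓕⁻ ψ` by a symbol corresponds to a local operation on `ψ`. -/
lemma exists_schwartz_symbol_mul_fourierInv (Q : MvPolynomial (Fin m) ℂ) {K : Set (RR m)}
    (hK : IsClosed K) (ψ : SchwartzMap (RR m) ℂ) (hψ : ∀ x ∉ K, ψ x = 0) :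
    ∃ θ : SchwartzMap (RR m) ℂ, (∀ x ∉ K, θ x = 0) ∧
      ∀ ξ, symbol Q ξ * (𝓕⁻ ψ : SchwartzMap (RR m) ℂ) ξ =
        (𝓕⁻ θ : SchwartzMap (RR m) ℂ) ξ := by
  induction Q using MvPolynomial.induction_on generalizing ψ with
  | C c =>
    refine ⟨c • ψ, fun x hx => by simp [hψ x hx], fun ξ => ?_⟩
    rw [FourierTransform.fourierInv_smul]
    simp [symbol]
  | add p q hp hq =>
    obtain ⟨θ₁, h1, h1'⟩ := hp ψ hψ
    obtain ⟨θ₂, h2, h2'⟩ := hq ψ hψ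
    refine ⟨θ₁ + θ₂, fun x hx => by simp [h1 x hx, h2 x hx], fun ξ => ?_⟩
    rw [FourierTransform.fourierInv_add, add_apply, ← h1', ← h2', ← add_mul]
    simp [symbol]
  | mul_X p j hp =>
    let e : RR m := EuclideanSpace.single j 1
    -- Multiplication by `2πi ξ_j` on the side of `𝓕⁻ ψ` is `-∂_j` on `ψ`. The complement of `K` is
    -- open, so `ψ` vanishes near each of its points and so does the derivative there.
    have hd : ∀ x ∉ K, (-(LineDeriv.lineDerivOp e ψ) : SchwartzMap (RR m) ℂ) x = 0 := by
      intro x hx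
      have : (ψ : RR m → ℂ) =ᶠ[nhds x] fun _ => 0 := by
        filter_upwards [hK.isOpen_compl.mem_nhds hx] with y hy using hψ y hy
      simp only [neg_apply, SchwartzMap.lineDerivOp_apply_eq_fderiv, neg_eq_zero]
      rw [this.fderiv_eq]
      simp
    obtain ⟨θ, h1, h2⟩ := hp _ hd
    refine ⟨θ, h1, fun ξ => ?_⟩
    have ht : (fun x : RR m => inner ℝ x e).HasTemperateGrowth := by fun_prop
    rw [← h2, FourierTransform.fourierInv_neg, neg_apply,
      SchwartzMap.fourierInv_lineDerivOp_eq, smul_apply,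
      SchwartzMap.smulLeftCLM_apply_apply ht]
    simp [symbol, e, EuclideanSpace.inner_single_right]
    ring

lemma continuous_fourierInv {h : RR m → ℂ} (hi : Integrable h) : Continuous (𝓕⁻ h) :=
  VectorFourier.fourierIntegral_continuous Real.continuous_fourierChar
    (by exact continuous_inner.neg) hi

/-- A differential operator does not enlarge supports. -/
lemma diffOp_ae_eq_zero {Q : MvPolynomial (Fin m) ℂ} {u : L2 m} {U : Set (RR m)}
    (hU : IsOpen U) (hi : Integrable fun ξ : RR m => symbol Q ξ * (𝓕 u : L2 m) ξ)
    (hu : ∀ᵐ x, x ∈ U → u x = 0) : ∀ᵐ x, x ∈ U → diffOp Q u x = 0 := by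
  refine hU.ae_eq_zero_of_integral_contDiff_smul_eq_zero
    ((continuous_fourierInv hi).locallyIntegrable.locallyIntegrableOn U) fun φ hφ hφc hφU => ?_
  have hc : HasCompactSupport fun x => ((φ x : ℝ) : ℂ) := hφc.comp_left Complex.ofReal_zero
  let ψ : SchwartzMap (RR m) ℂ := hc.toSchwartzMap (Complex.ofRealCLM.contDiff.comp hφ)
  have hψ : ∀ x, ψ x = φ x := fun x => rfl
  -- The symbol is moved from `û` to the test function by duality. The new test function `θ` is
  -- still supported in the support of `φ`, hence inside `U`, where `u` vanishes.
  obtain ⟨θ, hθ, hθ'⟩ := exists_schwartz_symbol_mul_fourierInv Q (isClosed_tsupport φ) ψ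
    fun x hx => by simp [hψ, image_eq_zero_of_notMem_tsupport hx]
  have e2 : ∫ x, diffOp Q u x • ψ x =
      ∫ ξ, (symbol Q ξ * (𝓕 u : L2 m) ξ) • 𝓕⁻ (ψ : RR m → ℂ) ξ := by
    have := VectorFourier.integral_fourierIntegral_smul_eq_flip (μ := volume) (ν := volume)
      (L := -innerₗ (RR m)) Real.continuous_fourierChar (by exact continuous_inner.neg) hi
      ψ.integrable
    have hf : (-innerₗ (RR m)).flip = -innerₗ (RR m) := by
      ext x y; simp [real_inner_comm]
    rw [hf] at this
    exact this
  calc ∫ x, φ x • diffOp Q u x = ∫ x, diffOp Q u x • ψ x := by simp [hψ, mul_comm]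
    _ = ∫ ξ, (𝓕⁻ θ : SchwartzMap (RR m) ℂ) ξ * (𝓕 u : L2 m) ξ := by
        rw [e2]
        refine integral_congr_ae (.of_forall fun ξ => ?_)
        simp only [smul_eq_mul]
        rw [← hθ', SchwartzMap.fourierInv_coe]
        ring
    _ = ∫ x, θ x * u x := by
        rw [integral_fourier_mul_schwartz, FourierTransform.fourier_fourierInv_eq]
    _ = 0 := by
        refine integral_eq_zero_of_ae ?_
        filter_upwards [hu] with x hx
        by_cases hK : x ∈ tsupport φ
        · simp [hx (hφU hK)]
        · simp [hθ x hK]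

/-- The half-open cube `(-d, d]^m`. -/
def cubeIoc (m : ℕ) (d : ℝ) : Set (RR m) := {x | ∀ i, x i ∈ Set.Ioc (-d) d}

/-- The closed cube `[-d, d]^m`. -/
def cubeIcc (m : ℕ) (d : ℝ) : Set (RR m) := {x | ∀ i, x i ∈ Set.Icc (-d) d}

/-- The boundary of a box is null. Therefore the open cube, the half-open one that tiles space and
the closed one with open complement are interchangeable in integrals. -/
lemma ae_mem_cube_of_mem_cubeIcc (d : ℝ) : ∀ᵐ x : RR m, x ∈ cubeIcc m d → x ∈ cube m d := by
  have h : (Set.univ.pi fun _ : Fin m => Set.Ioo (-d) d) =ᵐ[volume]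
      Set.Icc (fun _ : Fin m => -d) (fun _ => d) := Measure.univ_pi_Ioo_ae_eq_Icc
  have := (EuclideanSpace.volume_preserving_symm_measurableEquiv_toLp
    (Fin m)).quasiMeasurePreserving.tendsto_ae.eventually h
  filter_upwards [this] with x hx hI
  rw [cube_eq]
  refine hx.mpr ?_
  exact ⟨fun i => (hI i).1, fun i => (hI i).2⟩

lemma cube_ae_eq_cubeIoc (m : ℕ) (d : ℝ) : cube m d =ᵐ[volume] cubeIoc m d := by
  filter_upwards [ae_mem_cube_of_mem_cubeIcc (m := m) d] with x hx
  exact propext ⟨fun h i => ⟨(h i).1, (h i).2.le⟩,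
    fun h => hx fun i => Set.Ioc_subset_Icc_self (h i)⟩

lemma isClosed_cubeIcc (m : ℕ) (d : ℝ) : IsClosed (cubeIcc m d) := by
  simp only [cubeIcc, Set.ofPred_forall]
  exact isClosed_iInter fun i => isClosed_Icc.preimage (by fun_prop)

/-- Locality requires an open set, so it is applied to the complement of the closed cube; the
boundary that is left out is null. -/
lemma diffOp_eq_zero_off_cube {Q : MvPolynomial (Fin m) ℂ} {u : L2 m} {d : ℝ}
    (hi : Integrable fun ξ : RR m => symbol Q ξ * (𝓕 u : L2 m) ξ)
    (hu : ∀ᵐ x, x ∉ cube m d → u x = 0) : ∀ᵐ x, x ∉ cube m d → diffOp Q u x = 0 := by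
  have h := diffOp_ae_eq_zero (isClosed_cubeIcc m d).isOpen_compl hi (by
    filter_upwards [hu] with x hx hx'
    exact hx fun h => hx' fun i => ⟨(h i).1.le, (h i).2.le⟩)
  filter_upwards [h, ae_mem_cube_of_mem_cubeIcc (m := m) d] with x h1 h2 hx
  exact h1 fun h => hx (h2 h)

namespace Nonlinearity

variable {G : Nonlinearity m} {u₀ : L2 m}

/-- Each factor is the inverse Fourier integral of an integrable function, hence continuous. -/
lemma continuous_v (h : ∀ i ∈ Finset.Icc 2 G.N, ∀ k ∈ G.J i, ∀ r : Fin i,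
      Integrable fun ξ : RR m => symbol (G.op i k r) ξ * (𝓕 u₀ : L2 m) ξ) (α : Fin m →₀ ℕ) :
    Continuous (G.v u₀ α) := by
  unfold v
  refine continuous_finsetSum _ fun i hi => continuous_finsetSum _ fun k hk =>
    continuous_finsetSum _ fun p _ => continuous_const.mul ?_
  exact continuous_finsetProd _ fun q _ => continuous_fourierInv (h i hi k hk q)

lemma exists_bound_v (G : Nonlinearity m) (u₀ : L2 m) (α : Fin m →₀ ℕ) :
    ∃ B, ∀ x, ‖G.v u₀ α x‖ ≤ B := by
  -- This holds for every `Q`: without integrability both sides are zero by the convention for the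
  -- integral.
  have hb : ∀ (Q : MvPolynomial (Fin m) ℂ) x,
      ‖diffOp Q u₀ x‖ ≤ ∫ ξ, ‖symbol Q ξ * (𝓕 u₀ : L2 m) ξ‖ := fun Q x =>
    VectorFourier.norm_fourierIntegral_le_integral_norm _ _ _ _ _
  refine ⟨∑ i ∈ Finset.Icc 2 G.N, ∑ k ∈ G.J i, ∑ p : Fin i,
    ‖MvPolynomial.coeff α (G.op i k p)‖ * ∏ q ∈ Finset.univ.erase p,
      ∫ ξ, ‖symbol (G.op i k q) ξ * (𝓕 u₀ : L2 m) ξ‖, fun x => ?_⟩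
  unfold v
  refine norm_sum_le_of_le _ fun i _ => norm_sum_le_of_le _ fun k _ => norm_sum_le_of_le _
    fun p _ => ?_
  rw [norm_mul, norm_prod]
  gcongr
  exact hb _ _

lemma v_eq_zero_off_cube (h : ∀ i ∈ Finset.Icc 2 G.N, ∀ k ∈ G.J i, ∀ r : Fin i,
      Integrable fun ξ : RR m => symbol (G.op i k r) ξ * (𝓕 u₀ : L2 m) ξ) (α : Fin m →₀ ℕ)
    {d : ℝ} (hu : ∀ᵐ x, x ∉ cube m d → u₀ x = 0) :
    ∀ᵐ x, x ∉ cube m d → G.v u₀ α x = 0 := by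
  have h' : ∀ᵐ x, ∀ i ∈ Finset.Icc 2 G.N, ∀ k ∈ G.J i, ∀ r : Fin i, x ∉ cube m d →
      diffOp (G.op i k r) u₀ x = 0 := by
    refine (Finset.eventually_all _).2 fun i hi => (Finset.eventually_all _).2 fun k hk =>
      Filter.eventually_all.2 fun r => diffOp_eq_zero_off_cube (h i hi k hk r) hu
  filter_upwards [h'] with x hx hxc
  unfold v
  refine Finset.sum_eq_zero fun i hi => Finset.sum_eq_zero fun k hk => Finset.sum_eq_zero
    fun p _ => ?_
  -- Since `i ≥ 2`, the product over `q ≠ p` is not empty, and one vanishing factor suffices.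
  have : Nontrivial (Fin i) := Fin.nontrivial_iff_two_le.2 (Finset.mem_Icc.1 hi).1
  obtain ⟨q, hq⟩ := exists_ne p
  rw [Finset.prod_eq_zero (Finset.mem_erase.2 ⟨hq, Finset.mem_univ q⟩) (hx i hi k hk q hxc),
    mul_zero]

end Nonlinearity

end Coefficients

/-! ### Fourier series on the cube: completeness and Parseval's identity -/

section Torus

variable {m : ℕ}

/-- The torus carries the Haar probability measure. -/
local instance : MeasureSpace UnitAddCircle := ⟨AddCircle.haarAddCircle⟩

local instance : Measure.IsAddHaarMeasure (volume : Measure UnitAddCircle) :=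
  inferInstanceAs (Measure.IsAddHaarMeasure AddCircle.haarAddCircle)

local instance : IsProbabilityMeasure (volume : Measure UnitAddCircle) :=
  inferInstanceAs (IsProbabilityMeasure AddCircle.haarAddCircle)

/-- The half-open unit cube centred at the origin. -/
def unitCube (m : ℕ) : Set (Fin m → ℝ) := {x | ∀ i, x i ∈ Set.Ioc (-1 / 2 : ℝ) (-1 / 2 + 1)}

/-- The scaling `x ↦ x / (2d)`. -/
def scaleEquiv (m : ℕ) {d : ℝ} (hd : 0 < d) : RR m ≃ᵐ (Fin m → ℝ) :=
  (MeasurableEquiv.toLp 2 (Fin m → ℝ)).symm.trans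
    (Homeomorph.smulOfNeZero ((2 * d)⁻¹ : ℝ) (by positivity)).toMeasurableEquiv

lemma scaleEquiv_apply {d : ℝ} (hd : 0 < d) (x : RR m) (i : Fin m) :
    scaleEquiv m hd x i = (2 * d)⁻¹ * x i := rfl

lemma scaleEquiv_preimage {d : ℝ} (hd : 0 < d) :
    scaleEquiv m hd ⁻¹' unitCube m = cubeIoc m d := by
  ext x
  simp only [unitCube, cubeIoc, Set.mem_preimage, Set.mem_ofPred_eq, scaleEquiv_apply, Set.mem_Ioc]
  refine forall_congr' fun i => and_congr ?_ ?_
  · rw [← mul_lt_mul_iff_right₀ (by positivity : 0 < 2 * d), mul_inv_cancel_left₀ (by positivity)]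
    ring_nf
  · rw [← mul_le_mul_iff_right₀ (by positivity : 0 < 2 * d), mul_inv_cancel_left₀ (by positivity)]
    ring_nf

lemma map_scaleEquiv {d : ℝ} (hd : 0 < d) :
    Measure.map (scaleEquiv m hd) (volume.restrict (cubeIoc m d)) =
      ENNReal.ofReal ((2 * d) ^ m) • volume.restrict (unitCube m) := by
  rw [← scaleEquiv_preimage hd, ← MeasurableEquiv.restrict_map]
  have : Measure.map (scaleEquiv m hd) volume =
      ENNReal.ofReal ((2 * d) ^ m) • (volume : Measure (Fin m → ℝ)) := by
    change Measure.map (fun x : RR m => ((2 * d)⁻¹ : ℝ) •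
      (MeasurableEquiv.toLp 2 (Fin m → ℝ)).symm x) volume = _
    have h := Measure.map_map (μ := (volume : Measure (RR m)))
      (measurable_const_smul ((2 * d)⁻¹ : ℝ))
      (MeasurableEquiv.toLp 2 (Fin m → ℝ)).symm.measurable
    rw [(EuclideanSpace.volume_preserving_symm_measurableEquiv_toLp (Fin m)).map_eq,
      Measure.map_addHaar_smul _ (by positivity)] at h
    refine h.symm.trans ?_
    rw [Module.finrank_fin_fun, inv_pow, inv_inv, abs_of_pos (by positivity)]
  rw [this, Measure.restrict_smul]

/-- The projection of `ℝ^m` to the torus that identifies the half-open cube with the torus. -/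
def toTorus (d : ℝ) (x : RR m) : UnitAddTorus (Fin m) :=
  fun i => (((2 * d)⁻¹ * x i : ℝ) : UnitAddCircle)

/-- The scaling by `1/(2d)` carries the half-open cube to the fundamental domain `(-1/2, 1/2]^m` of
the torus, with Jacobian factor `(2d)^m`. -/
lemma integral_torus {d : ℝ} (hd : 0 < d) (F : UnitAddTorus (Fin m) → ℂ) :
    ∫ x in cubeIoc m d, F (toTorus d x) = (((2 * d) ^ m : ℝ) : ℂ) * ∫ t, F t := by
  rw [UnitAddTorus.integral_preimage F (fun _ => -1 / 2)]
  have h := integral_map_equiv (μ := volume.restrict (cubeIoc m d)) (scaleEquiv m hd)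
    fun y => F fun i => (y i : UnitAddCircle)
  rw [map_scaleEquiv hd, integral_smul_measure, ENNReal.toReal_ofReal (by positivity)] at h
  refine h.symm.trans ?_
  rw [Complex.real_smul]
  rfl

lemma lintegral_torus {d : ℝ} (hd : 0 < d) (F : UnitAddTorus (Fin m) → ℝ≥0∞) :
    ∫⁻ x in cubeIoc m d, F (toTorus d x) = ENNReal.ofReal ((2 * d) ^ m) * ∫⁻ t, F t := by
  rw [UnitAddTorus.lintegral_preimage F (fun _ => -1 / 2)]
  have h := lintegral_map_equiv (μ := volume.restrict (cubeIoc m d))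
    (fun y => F fun i => (y i : UnitAddCircle)) (scaleEquiv m hd)
  rw [map_scaleEquiv hd, lintegral_smul_measure] at h
  exact h.symm

/-- The inverse of `toTorus` with values in the half-open cube. -/
def ofTorus {d : ℝ} (hd : 0 < d) (t : UnitAddTorus (Fin m)) : RR m :=
  (scaleEquiv m hd).symm (UnitAddTorus.measurableEquivPiIoc (fun _ => -1 / 2) t).1

lemma measurable_ofTorus {d : ℝ} (hd : 0 < d) :
    Measurable (ofTorus hd : UnitAddTorus (Fin m) → RR m) :=
  (scaleEquiv m hd).symm.measurable.comp
    (measurable_subtype_coe.comp (UnitAddTorus.measurableEquivPiIoc _).measurable)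

lemma ofTorus_toTorus {d : ℝ} (hd : 0 < d) {x : RR m} (hx : x ∈ cubeIoc m d) :
    ofTorus hd (toTorus d x) = x := by
  rw [← scaleEquiv_preimage hd] at hx
  have := (UnitAddTorus.measurableEquivPiIoc (fun _ : Fin m => (-1 / 2 : ℝ))).apply_symm_apply
    ⟨scaleEquiv m hd x, hx⟩
  have h2 : (UnitAddTorus.measurableEquivPiIoc (fun _ => -1 / 2) (toTorus d x)).1 =
      scaleEquiv m hd x := congrArg Subtype.val this
  rw [ofTorus, h2, MeasurableEquiv.symm_apply_apply]

lemma mFourier_toTorus (d : ℝ) (n : Fin m → ℤ) (x : RR m) :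
    UnitAddTorus.mFourier (-n) (toTorus d x) = Complex.exp (-phase d n x) := by
  change ∏ i, fourier ((-n) i) (((2 * d)⁻¹ * x i : ℝ) : UnitAddCircle) = _
  simp only [fourier_coe_apply, ← Complex.exp_sum]
  congr 1
  rw [phase]
  push_cast
  rw [Finset.mul_sum, ← Finset.sum_neg_distrib]
  refine Finset.sum_congr rfl fun i _ => ?_
  simp
  ring

lemma volume_real_cube {d : ℝ} (hd : 0 < d) : volume.real (cube m d) = (2 * d) ^ m := by
  rw [measureReal_def, volume_cube, ENNReal.toReal_pow, ENNReal.toReal_ofReal (by linarith)]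

lemma measurableSet_cubeIoc (m : ℕ) (d : ℝ) : MeasurableSet (cubeIoc m d) := by
  have : cubeIoc m d = (MeasurableEquiv.toLp 2 (Fin m → ℝ)).symm ⁻¹'
      (Set.univ.pi fun _ => Set.Ioc (-d) d) := by
    ext x; simp [cubeIoc, Set.mem_pi]
  rw [this]
  exact (MeasurableEquiv.measurable _) (MeasurableSet.univ_pi fun _ => measurableSet_Ioc)

/-- A square integrable function on the cube is determined by its Fourier coefficients. -/
lemma eq_zero_of_fourierSeries_eq_zero {d : ℝ} (hd : 0 < d) {h : L2 m}
    (h0 : ∀ᵐ x, x ∉ cube m d → h x = 0) (hn : ∀ n, fourierSeries d h n = 0) : h = 0 := by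
  -- The function is transported to the unit torus, where completeness of the exponentials in `L²`
  -- is available, and the conclusion `H = 0` is carried back.
  let H : UnitAddTorus (Fin m) → ℂ := fun t => h (ofTorus hd t)
  have hHm : Measurable H := (Lp.stronglyMeasurable h).measurable.comp (measurable_ofTorus hd)
  have hH : ∀ x ∈ cubeIoc m d, H (toTorus d x) = h x := fun x hx => by
    simp only [H, ofTorus_toTorus hd hx]
  have hc : ENNReal.ofReal ((2 * d) ^ m) ≠ 0 := by
    simpa using (by positivity : 0 < (2 * d) ^ m)
  have hL2 : MemLp H 2 (volume : Measure (UnitAddTorus (Fin m))) := by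
    refine ⟨hHm.aestronglyMeasurable, ?_⟩
    rw [eLpNorm_lt_top_iff_lintegral_rpow_enorm_lt_top (by norm_num) (by norm_num)]
    have e := lintegral_torus hd fun t => ‖H t‖ₑ ^ (2 : ℝ≥0∞).toReal
    rw [setLIntegral_congr_fun (measurableSet_cubeIoc m d)
      (fun x hx => by simp only [hH x hx] : Set.EqOn _ (fun x => ‖h x‖ₑ ^ (2 : ℝ≥0∞).toReal) _)]
      at e
    have f := (eLpNorm_lt_top_iff_lintegral_rpow_enorm_lt_top (by norm_num) (by norm_num)).1
      (Lp.memLp h).2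
    have g := (setLIntegral_le_lintegral (cubeIoc m d) _).trans_lt f
    rw [e] at g
    exact ENNReal.lt_top_of_mul_ne_top_right g.ne hc
  have hcoef : ∀ n, UnitAddTorus.mFourierCoeff H n = 0 := by
    intro n
    have e := integral_torus hd fun t => UnitAddTorus.mFourier (-n) t • H t
    rw [setIntegral_congr_fun (measurableSet_cubeIoc m d)
      (fun x hx => by
        simp only [hH x hx, mFourier_toTorus, smul_eq_mul, mul_comm] :
          Set.EqOn _ (fun x => h x * Complex.exp (-phase d n x)) _),
      ← setIntegral_congr_set (cube_ae_eq_cubeIoc m d)] at e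
    have hv := hn n
    rw [fourierSeries, e, volume_real_cube hd] at hv
    have hne : (((2 * d) ^ m : ℝ) : ℂ) ≠ 0 := by
      exact_mod_cast (by positivity : (2 * d) ^ m ≠ 0)
    rw [Complex.ofReal_inv, inv_mul_cancel_left₀ hne] at hv
    exact hv
  have hz : hL2.toLp H = 0 := by
    have hs := UnitAddTorus.hasSum_mFourier_series_L2 (hL2.toLp H)
    have : ∀ n, UnitAddTorus.mFourierCoeff (hL2.toLp H) n = 0 := by
      intro n
      rw [← hcoef n]
      exact integral_congr_ae (by
        filter_upwards [hL2.coeFn_toLp] with t ht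
        rw [ht])
    simp only [this, zero_smul] at hs
    exact hs.unique hasSum_zero
  have hz' : H =ᵐ[volume] 0 := by
    have := hL2.coeFn_toLp
    rw [hz] at this
    exact this.symm.trans (Lp.coeFn_zero _ _ _)
  have hl : ∫⁻ x in cubeIoc m d, ‖h x‖ₑ = 0 := by
    have e := lintegral_torus hd fun t => ‖H t‖ₑ
    rw [setLIntegral_congr_fun (measurableSet_cubeIoc m d)
      (fun x hx => by simp only [hH x hx] : Set.EqOn _ (fun x => ‖h x‖ₑ) _)] at e
    rw [e, (lintegral_eq_zero_iff hHm.enorm).2 (by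
      filter_upwards [hz'] with t ht
      simp [ht]), mul_zero]
  rw [lintegral_eq_zero_iff (Lp.stronglyMeasurable h).measurable.enorm, Filter.EventuallyEq,
    ae_restrict_iff' (measurableSet_cubeIoc m d)] at hl
  refine Lp.eq_zero_iff_ae_eq_zero.2 ?_
  filter_upwards [hl, h0] with x h1 h2
  by_cases hx : x ∈ cube m d
  · simpa using h1 fun i => Set.Ioo_subset_Ioc_self (hx i)
  · exact h2 hx

end Torus

/-! ### Convergence of Fourier series, Parseval's identity and the pairing as a weighted norm -/

section Parseval

variable {m : ℕ}

lemma fourierSeries_congr {d : ℝ} {u w : RR m → ℂ} (h : ∀ᵐ x, x ∈ cube m d → u x = w x)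
    (n : Fin m → ℤ) : fourierSeries d u n = fourierSeries d w n := by
  rw [fourierSeries, fourierSeries]
  congr 1
  refine setIntegral_congr_ae (measurableSet_cube m d) ?_
  filter_upwards [h] with x hx hc
  rw [hx hc]

lemma mode_ae_eq_zero (d : ℝ) (n : Fin m → ℤ) :
    ∀ᵐ x, x ∉ cube m d → (mode d n : L2 m) x = 0 := by
  filter_upwards [(memLp_modeFun (m := m) d n).coeFn_toLp] with x hx hc
  rw [mode, hx, modeFun, Set.indicator_of_notMem hc]

lemma indOp_cube_eq_self_iff {d : ℝ} {u : L2 m} :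
    indOp (cube m d) u = u ↔ ∀ᵐ x, x ∉ cube m d → u x = 0 := by
  have h := indOp_coeFn (measurableSet_cube m d) u
  constructor
  · intro e
    rw [e] at h
    filter_upwards [h] with x hx hc
    rw [hx, Set.indicator_of_notMem hc]
  · intro e
    refine Lp.ext ?_
    filter_upwards [h, e] with x hx he
    rw [hx]
    by_cases hc : x ∈ cube m d
    · rw [Set.indicator_of_mem hc]
    · rw [Set.indicator_of_notMem hc, he hc]

/-- The Fourier series of a square integrable function on the cube converges to the function. -/
lemma hasSum_fourierSeries {d : ℝ} (hd : 0 < d) {h : L2 m}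
    (h0 : ∀ᵐ x, x ∉ cube m d → h x = 0) :
    HasSum (fun n => fourierSeries d h n • (mode d n : L2 m)) h := by
  have hs := ((isBoundedLinearMap_periodicFun (m := m) hd (k := fun _ => 1) (C := 1)
    (by simp)).1 h)
  simp only [one_mul] at hs
  obtain ⟨s, hs⟩ := hs
  -- The sum `s` exists by the boundedness of `periodicFun`. It remains to see `s = h`: both are
  -- supported in the cube, and orthogonality of the modes gives them the same coefficients.
  have hsupp : indOp (cube m d) s = s := by
    have := hs.mapL (indOp (cube m d))
    refine this.unique ?_
    simpa only [map_smul, indOp_cube_eq_self_iff.2 (mode_ae_eq_zero d _)] using hs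
  have hc : (((2 * d) ^ m : ℝ) : ℂ) ≠ 0 := by
    exact_mod_cast (by positivity : (2 * d) ^ m ≠ 0)
  have hcoef : ∀ n, fourierSeries d s n = fourierSeries d h n := by
    intro n
    rw [fourierSeries_eq_inner hd s]
    have e1 := hs.mapL (innerSL ℂ (mode d n : L2 m))
    have e2 : HasSum (fun k => innerSL ℂ (mode d n : L2 m)
        (fourierSeries d h k • (mode d k : L2 m)))
        (fourierSeries d h n * (((2 * d) ^ m : ℝ) : ℂ)) := by
      convert! hasSum_ite_eq n (fourierSeries d h n * (((2 * d) ^ m : ℝ) : ℂ)) using 2 with k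
      rw [innerSL_apply_apply, inner_smul_right, inner_mode hd]
      by_cases hk : n = k
      · simp [hk]
      · simp [hk, Ne.symm hk]
    have e3 := e1.unique e2
    rw [innerSL_apply_apply] at e3
    rw [e3, Complex.ofReal_inv]
    field_simp
  have : s - h = 0 := by
    refine eq_zero_of_fourierSeries_eq_zero hd ?_ fun n => ?_
    · rw [← indOp_cube_eq_self_iff, map_sub, hsupp, indOp_cube_eq_self_iff.2 h0]
    · have := hcoef n
      rw [fourierSeries_eq_inner hd] at this ⊢
      rw [inner_sub_right, mul_sub, this, fourierSeries_eq_inner hd, sub_self]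
  rwa [sub_eq_zero.1 this] at hs

/-- Parseval's identity. -/
lemma hasSum_conj_fourierSeries_mul {d : ℝ} (hd : 0 < d) {h : L2 m}
    (h0 : ∀ᵐ x, x ∉ cube m d → h x = 0) (g : L2 m) :
    HasSum (fun n => (starRingEnd ℂ) (fourierSeries d h n) * fourierSeries d g n)
      ((((2 * d) ^ m)⁻¹ : ℝ) * inner ℂ h g) := by
  have e := ((hasSum_fourierSeries hd h0).mapL (innerSL ℂ g)).map (starRingEnd ℂ)
    Complex.continuous_conj
  have e2 := e.mul_left ((((2 * d) ^ m)⁻¹ : ℝ) : ℂ)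
  rw [innerSL_apply_apply, inner_conj_symm] at e2
  refine e2.congr_fun fun n => ?_
  rw [Function.comp_apply, innerSL_apply_apply, inner_smul_right, map_mul,
    inner_conj_symm, fourierSeries_eq_inner hd g n]
  ring

/-- An `L²` function on the cube is the value of `periodicOp` if it has the right Fourier
coefficients. -/
lemma periodicOp_eq {d : ℝ} (hd : 0 < d) {k : (Fin m → ℤ) → ℂ} {C : ℝ} (hk : ∀ n, ‖k n‖ ≤ C)
    {u w : L2 m} (hw : ∀ᵐ x, x ∉ cube m d → w x = 0)
    (h : ∀ n, fourierSeries d w n = k n * fourierSeries d u n) : periodicOp d k u = w := by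
  rw [periodicOp, dif_pos (isBoundedLinearMap_periodicFun hd hk).2]
  change periodicFun d k u = w
  rw [← (hasSum_fourierSeries hd hw).tsum_eq, periodicFun]
  simp only [h]

lemma memLp_cube_indicator {d B : ℝ} {u : RR m → ℂ} (hu : AEStronglyMeasurable u volume)
    (hB : ∀ x ∈ cube m d, ‖u x‖ ≤ B) :
    MemLp ((cube m d).indicator u) 2 (volume : Measure (RR m)) := by
  rw [memLp_indicator_iff_restrict (measurableSet_cube m d)]
  have : IsFiniteMeasure (volume.restrict (cube m d)) := ⟨by simpa using volume_cube_lt_top m d⟩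
  exact MemLp.of_bound hu.restrict B ((ae_restrict_iff' (measurableSet_cube m d)).2 (.of_forall hB))

lemma toLp_cube_indicator_ae_eq_zero {d : ℝ} {u : RR m → ℂ}
    (hu : MemLp ((cube m d).indicator u) 2 (volume : Measure (RR m))) :
    ∀ᵐ x, x ∉ cube m d → hu.toLp _ x = 0 := by
  filter_upwards [hu.coeFn_toLp] with x hx hc
  rw [hx, Set.indicator_of_notMem hc]

lemma fourierSeries_toLp_indicator {d : ℝ} {u : RR m → ℂ}
    (hu : MemLp ((cube m d).indicator u) 2 (volume : Measure (RR m))) (n : Fin m → ℤ) :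
    fourierSeries d (hu.toLp _) n = fourierSeries d u n := by
  refine fourierSeries_congr ?_ n
  filter_upwards [hu.coeFn_toLp] with x hx hc
  rw [hx, Set.indicator_of_mem hc]

/-- Parseval's identity for bounded functions on the cube. -/
lemma hasSum_conj_fourierSeries_mul_of_bound {d B₁ B₂ : ℝ} (hd : 0 < d) {u w : RR m → ℂ}
    (hu : AEStronglyMeasurable u volume) (hw : AEStronglyMeasurable w volume)
    (hB₁ : ∀ x ∈ cube m d, ‖u x‖ ≤ B₁) (hB₂ : ∀ x ∈ cube m d, ‖w x‖ ≤ B₂) :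
    HasSum (fun n => (starRingEnd ℂ) (fourierSeries d u n) * fourierSeries d w n)
      ((((2 * d) ^ m)⁻¹ : ℝ) * ∫ x in cube m d, (starRingEnd ℂ) (u x) * w x) := by
  have hu2 := memLp_cube_indicator hu hB₁
  have hw2 := memLp_cube_indicator hw hB₂
  have h := hasSum_conj_fourierSeries_mul hd (toLp_cube_indicator_ae_eq_zero hu2) (hw2.toLp _)
  simp only [fourierSeries_toLp_indicator] at h
  convert! h using 2
  rw [L2.inner_def, ← integral_indicator (measurableSet_cube m d)]
  refine integral_congr_ae ?_
  filter_upwards [hu2.coeFn_toLp, hw2.coeFn_toLp] with x h1 h2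
  rw [h1, h2]
  by_cases hx : x ∈ cube m d
  · simp [hx, mul_comm]
  · simp [hx]

lemma phase_sub (d : ℝ) (n k : Fin m → ℤ) (x : RR m) :
    phase d (n - k) x = phase d n x - phase d k x := by
  have : ∑ j, (((n - k) j : ℤ) : ℝ) / (2 * d) * x j =
      ∑ j, (n j : ℝ) / (2 * d) * x j - ∑ j, (k j : ℝ) / (2 * d) * x j := by
    rw [← Finset.sum_sub_distrib]
    refine Finset.sum_congr rfl fun j _ => ?_
    simp only [Pi.sub_apply]
    push_cast
    ring
  simp only [phase, this]
  push_cast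
  ring

lemma conj_phase (d : ℝ) (n : Fin m → ℤ) (x : RR m) :
    (starRingEnd ℂ) (phase d n x) = -phase d n x := by
  simp only [phase, map_mul, Complex.conj_I, Complex.conj_ofReal, map_ofNat]
  ring

/-- The convolution of the Fourier coefficients of `v` and of a real function `e` gives the
Fourier coefficients of `e v`. -/
lemma hasSum_seqConv {d B₁ B₂ : ℝ} (hd : 0 < d) {v : RR m → ℂ} {e : RR m → ℝ}
    (hv : AEStronglyMeasurable v volume) (he : Continuous e)
    (hB₁ : ∀ x ∈ cube m d, ‖v x‖ ≤ B₁) (hB₂ : ∀ x ∈ cube m d, |e x| ≤ B₂) (n : Fin m → ℤ) :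
    HasSum (fun k => fourierSeries d v k * fourierSeries d (fun x => (e x : ℂ)) (n - k))
      (fourierSeries d (fun x => (e x : ℂ) * v x) n) := by
  -- Parseval is applied to `e(x) e^{2πi ñ·x}` and `v`. As `e` is real, the conjugate of the `k`-th
  -- coefficient of the first function is the coefficient of `e` at `n - k`.
  have h := hasSum_conj_fourierSeries_mul_of_bound hd
    (u := fun x => (e x : ℂ) * Complex.exp (phase d n x)) (w := v) (B₁ := B₂)
    ((Complex.continuous_ofReal.comp he).mul
      (Complex.continuous_exp.comp (continuous_phase d n))).aestronglyMeasurable hv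
    (fun x hx => by simpa [norm_mul, norm_exp_phase] using hB₂ x hx) hB₁
  have h2 : (((2 * d) ^ m)⁻¹ : ℝ) * ∫ x in cube m d,
      (starRingEnd ℂ) ((e x : ℂ) * Complex.exp (phase d n x)) * v x =
      fourierSeries d (fun x => (e x : ℂ) * v x) n := by
    rw [fourierSeries, volume_real_cube hd]
    congr 1
    refine integral_congr_ae (.of_forall fun x => ?_)
    simp only [map_mul, Complex.conj_ofReal, ← Complex.exp_conj, conj_phase]
    ring
  rw [h2] at h
  refine h.congr_fun fun k => ?_
  rw [mul_comm]
  congr 1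
  rw [fourierSeries, fourierSeries, map_mul, Complex.conj_ofReal, ← integral_conj]
  congr 1
  refine integral_congr_ae (.of_forall fun x => ?_)
  simp only [map_mul, Complex.conj_ofReal, ← Complex.exp_conj, phase_sub, mul_assoc,
    ← Complex.exp_add]
  congr 2
  rw [map_add, map_neg, conj_phase, conj_phase]
  ring

/-- The pairing `(V^*, V * E)₂` is the weighted `L²` norm `|Ω₀|⁻¹ ∫_{Ω₀} |v|² e`. -/
lemma pairing_eq {d B₁ B₂ : ℝ} (hd : 0 < d) {v : RR m → ℂ} {e : RR m → ℝ}
    (hv : AEStronglyMeasurable v volume) (he : Continuous e)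
    (hB₁ : ∀ x ∈ cube m d, ‖v x‖ ≤ B₁) (hB₂ : ∀ x ∈ cube m d, |e x| ≤ B₂)
    (he0 : ∀ x ∈ cube m d, 0 ≤ e x) :
    PairingWellDefined (fourierSeries d v) (fourierSeries d fun x => (e x : ℂ)) ∧
      volume.real (cube m d) *
        pairing (fourierSeries d v) (fourierSeries d fun x => (e x : ℂ)) =
        ∫ x in cube m d, ‖v x‖ ^ 2 * e x := by
  have hconv : ∀ n, seqConv (fourierSeries d v) (fourierSeries d fun x => (e x : ℂ)) n =
      fourierSeries d (fun x => (e x : ℂ) * v x) n := fun n =>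
    (hasSum_seqConv hd hv he hB₁ hB₂ n).tsum_eq
  have h := hasSum_conj_fourierSeries_mul_of_bound hd (u := v)
    (w := fun x => (e x : ℂ) * v x) (B₂ := B₂ * B₁) hv
    ((Complex.continuous_ofReal.comp he).aestronglyMeasurable.mul hv) hB₁
    (fun x hx => by
      rw [norm_mul, Complex.norm_real, Real.norm_eq_abs]
      exact mul_le_mul (hB₂ x hx) (hB₁ x hx) (norm_nonneg _) ((abs_nonneg _).trans (hB₂ x hx)))
  have hint : ∫ x in cube m d, (starRingEnd ℂ) (v x) * ((e x : ℂ) * v x) =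
      ((∫ x in cube m d, ‖v x‖ ^ 2 * e x : ℝ) : ℂ) := by
    rw [← integral_complex_ofReal]
    refine integral_congr_ae (.of_forall fun x => ?_)
    simp only
    rw [mul_left_comm, ← Complex.normSq_eq_conj_mul_self, Complex.normSq_eq_norm_sq]
    push_cast
    ring
  rw [hint, ← Complex.ofReal_mul] at h
  have hpair : seqPair (seqConj (fourierSeries d v))
      (seqConv (fourierSeries d v) (fourierSeries d fun x => (e x : ℂ))) =
      ((((2 * d) ^ m)⁻¹ * ∫ x in cube m d, ‖v x‖ ^ 2 * e x : ℝ) : ℂ) := by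
    rw [seqPair]
    simp only [hconv]
    exact h.tsum_eq
  have hnn : 0 ≤ ∫ x in cube m d, ‖v x‖ ^ 2 * e x :=
    setIntegral_nonneg (measurableSet_cube m d) fun x hx => mul_nonneg (by positivity) (he0 x hx)
  refine ⟨⟨fun n => (hasSum_seqConv hd hv he hB₁ hB₂ n).summable, ?_, ?_, ?_⟩, ?_⟩
  · simp only [hconv]
    exact h.summable
  · rw [hpair, Complex.ofReal_im]
  · rw [hpair, Complex.ofReal_re]
    positivity
  · rw [pairing, hpair, Complex.ofReal_re, volume_real_cube hd, mul_inv_cancel_left₀]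
    positivity

end Parseval

/-! ### Interaction of the translates of the kernel -/

section Lattice

/-- The decay exponent, in units of the period, of the product of two translates of the kernel in
one coordinate. -/
def crossExp (j k : ℤ) : ℕ :=
  if 0 < j ∧ 0 < k ∨ j < 0 ∧ k < 0 then j.natAbs + k.natAbs - 1 else j.natAbs + k.natAbs

lemma natAbs_le_crossExp_left (j k : ℤ) : j.natAbs ≤ crossExp j k := by
  unfold crossExp; split_ifs <;> omega

lemma natAbs_le_crossExp_right (j k : ℤ) : k.natAbs ≤ crossExp j k := by
  unfold crossExp; split_ifs <;> omega

/-- The triangle inequality removes `y` and `z`. If `j` and `k` do not have the same strict sign,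
`x` cancels in a lower bound for `|x + 2dj| + |x + 2dk|`, and `2d(|j| + |k|)` remains. If they do,
`2x` survives and costs at most `2d` because `|x| < d`; hence the `-1` in `crossExp`. -/
lemma crossExp_le_dist {d x y z : ℝ} (h1 : -d < x) (h2 : x < d) (j k : ℤ) :
    2 * d * crossExp j k ≤ |x + 2 * d * j - y| + |x + 2 * d * k - z| + |y| + |z| := by
  have e1 := le_abs_self (x + 2 * d * j - y)
  have e1' := neg_abs_le (x + 2 * d * j - y)
  have e2 := le_abs_self (x + 2 * d * k - z)
  have e2' := neg_abs_le (x + 2 * d * k - z)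
  have e3 := le_abs_self y
  have e3' := neg_abs_le y
  have e4 := le_abs_self z
  have e4' := neg_abs_le z
  have hn : ∀ i : ℤ, (i.natAbs : ℝ) = |(i : ℝ)| := fun i => by
    rw [← Int.cast_abs, Int.abs_eq_natAbs, Int.cast_natCast]
  rcases lt_trichotomy j 0 with hj | hj | hj <;> rcases lt_trichotomy k 0 with hk | hk | hk
  all_goals first
    | have hj' : (j : ℝ) < 0 := by exact_mod_cast hj
    | have hj' : (0 : ℝ) < j := by exact_mod_cast hj
    | subst hj
  all_goals first
    | have hk' : (k : ℝ) < 0 := by exact_mod_cast hk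
    | have hk' : (0 : ℝ) < k := by exact_mod_cast hk
    | subst hk
  · have : ((crossExp j k : ℕ) : ℝ) = -j - k - 1 := by
      rw [crossExp, if_pos (Or.inr ⟨hj, hk⟩), Nat.cast_sub (by omega)]
      push_cast [hn]
      rw [abs_of_neg hj', abs_of_neg hk']; ring
    rw [this]; linarith
  · have : ((crossExp j 0 : ℕ) : ℝ) = -j := by
      rw [crossExp, if_neg (by omega)]
      push_cast [hn]
      rw [abs_of_neg hj']; simp
    rw [this]; push_cast at *; linarith
  · have : ((crossExp j k : ℕ) : ℝ) = -j + k := by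
      rw [crossExp, if_neg (by omega)]
      push_cast [hn]
      rw [abs_of_neg hj', abs_of_pos hk']
    rw [this]; linarith
  · have : ((crossExp 0 k : ℕ) : ℝ) = -k := by
      rw [crossExp, if_neg (by omega)]
      push_cast [hn]
      rw [abs_of_neg hk']; simp
    rw [this]; push_cast at *; linarith
  · have : ((crossExp 0 0 : ℕ) : ℝ) = 0 := by simp [crossExp]
    rw [this, mul_zero]; positivity
  · have : ((crossExp 0 k : ℕ) : ℝ) = k := by
      rw [crossExp, if_neg (by omega)]
      push_cast [hn]
      rw [abs_of_pos hk']; simp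
    rw [this]; push_cast at *; linarith
  · have : ((crossExp j k : ℕ) : ℝ) = j - k := by
      rw [crossExp, if_neg (by omega)]
      push_cast [hn]
      rw [abs_of_pos hj', abs_of_neg hk']; ring
    rw [this]; linarith
  · have : ((crossExp j 0 : ℕ) : ℝ) = j := by
      rw [crossExp, if_neg (by omega)]
      push_cast [hn]
      rw [abs_of_pos hj']; simp
    rw [this]; push_cast at *; linarith
  · have : ((crossExp j k : ℕ) : ℝ) = j + k - 1 := by
      rw [crossExp, if_pos (Or.inl ⟨hj, hk⟩), Nat.cast_sub (by omega)]
      push_cast [hn]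
      rw [abs_of_pos hj', abs_of_pos hk']
    rw [this]; linarith

variable {m : ℕ}

/-- The total decay exponent of the product of two translates of the kernel. -/
def crossSum (j k : Fin m → ℤ) : ℕ := ∑ i, crossExp (j i) (k i)

lemma crossExp_le_crossSum (j k : Fin m → ℤ) (i : Fin m) :
    crossExp (j i) (k i) ≤ crossSum j k :=
  Finset.single_le_sum (f := fun i => crossExp (j i) (k i)) (fun _ _ => Nat.zero_le _)
    (Finset.mem_univ i)

/-- The source of `e^{-4ad}`. At a coordinate where `j` and `k` differ, two nonzero entries
contribute at least `2`: with equal signs their moduli add up to at least `3`, of which one is lost.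
If one entry is zero there, this coordinate contributes at least `1`, and so does another one at
which that vector is nonzero. -/
lemma two_le_crossSum {j k : Fin m → ℤ} (hj : j ≠ 0) (hk : k ≠ 0) (hjk : j ≠ k) :
    2 ≤ crossSum j k := by
  obtain ⟨i, hi⟩ := Function.ne_iff.1 hjk
  have two : ∀ i', i' ≠ i → 1 ≤ crossExp (j i) (k i) → 1 ≤ crossExp (j i') (k i') →
      2 ≤ crossSum j k := by
    intro i' hi' h1 h2
    have := Finset.add_le_sum (f := fun i => crossExp (j i) (k i)) (fun _ _ => Nat.zero_le _)
      (Finset.mem_univ i) (Finset.mem_univ i') hi'.symm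
    exact (add_le_add h1 h2).trans this
  by_cases h0 : j i = 0
  · obtain ⟨i', hi'⟩ := Function.ne_iff.1 hj
    refine two i' (fun h => hi' (h ▸ h0)) ?_ ?_
    · have := natAbs_le_crossExp_right (j i) (k i); omega
    · have := natAbs_le_crossExp_left (j i') (k i'); simp at hi'; omega
  by_cases h0' : k i = 0
  · obtain ⟨i', hi'⟩ := Function.ne_iff.1 hk
    refine two i' (fun h => hi' (h ▸ h0')) ?_ ?_
    · have := natAbs_le_crossExp_left (j i) (k i); omega
    · have := natAbs_le_crossExp_right (j i') (k i'); simp at hi'; omega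
  · refine le_trans ?_ (crossExp_le_crossSum j k i)
    unfold crossExp
    split_ifs <;> omega

/-- The translation vector `2dj`. -/
def shift (d : ℝ) (j : Fin m → ℤ) : RR m := WithLp.toLp 2 fun i => 2 * d * j i

lemma shift_apply (d : ℝ) (j : Fin m → ℤ) (i : Fin m) : shift d j i = 2 * d * j i := rfl

lemma crossSum_le_dist {d : ℝ} {x : RR m} (hx : x ∈ cube m d) (y z : RR m) (j k : Fin m → ℤ) :
    2 * d * crossSum j k ≤ ∑ i, |(x + shift d j - y) i| + ∑ i, |(x + shift d k - z) i| +
      ∑ i, |y i| + ∑ i, |z i| := by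
  rw [crossSum, Nat.cast_sum, Finset.mul_sum, ← Finset.sum_add_distrib, ← Finset.sum_add_distrib,
    ← Finset.sum_add_distrib]
  exact Finset.sum_le_sum fun i _ => crossExp_le_dist (hx i).1 (hx i).2 (j i) (k i)

/-- A summable majorant on `ℤ`. -/
def latticeWeight (n : ℤ) : ℝ := (if n = 0 then 1 else 0) + 1 / (n : ℝ) ^ 2

lemma latticeWeight_nonneg (n : ℤ) : 0 ≤ latticeWeight n := by
  unfold latticeWeight; positivity

lemma summable_latticeWeight : Summable latticeWeight :=
  (hasSum_ite_eq (0 : ℤ) (1 : ℝ)).summable.add (Real.summable_one_div_int_pow.2 one_lt_two)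

/-- The weight at `n = 0` is `1`, because `1 / 0 ^ 2` is `0` by convention. The lemma is applied
with `c` the total exponent, which dominates every coordinate of both lattice points. -/
lemma inv_sq_le_latticeWeight {c : ℕ} (hc : 1 ≤ c) {n : ℤ} (hn : n.natAbs ≤ c) :
    ((c : ℝ) ^ 2)⁻¹ ≤ latticeWeight n := by
  unfold latticeWeight
  by_cases h : n = 0
  · subst h
    simp only [if_true, Int.cast_zero]
    have : (1 : ℝ) ≤ (c : ℝ) ^ 2 := one_le_pow₀ (by exact_mod_cast hc)
    have := inv_le_one_of_one_le₀ this
    simpa using this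
  · rw [if_neg h, zero_add, one_div]
    have h1 : |(n : ℝ)| ≤ c := by
      rw [← Int.cast_abs, Int.abs_eq_natAbs]
      exact_mod_cast hn
    have h2 : 0 < (n : ℝ) ^ 2 := by positivity
    exact inv_anti₀ h2 (sq_le_sq' (by linarith [neg_abs_le (n : ℝ)]) ((le_abs_self _).trans h1))

lemma tsum_pi_prod (f : ℤ → ℝ≥0∞) :
    ∑' j : Fin m → ℤ, ∏ i, f (j i) = (∑' n, f n) ^ m := by
  induction m with
  | zero => simp
  | succ m ih =>
    rw [← (Fin.consEquiv fun _ : Fin (m + 1) => ℤ).tsum_eq, ENNReal.tsum_prod']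
    simp only [Fin.consEquiv, Equiv.coe_fn_mk, Fin.prod_univ_succ, Fin.cons_zero, Fin.cons_succ,
      ENNReal.tsum_mul_left, ENNReal.tsum_mul_right, ih]
    rw [pow_succ']

/-- The rational majorant of the tail of the lattice sum. -/
def tailBound (m : ℕ) (t : ℝ) : ℝ := 2 ^ (4 * m) + (4 * m).factorial * 3 ^ (4 * m) / t ^ (4 * m)

/-- The two summands serve two cases. For `c = 2` the left side is `1 = 2^N / c^N`. For `c ≥ 3` one
has `c ≤ 3(c - 2)`, and `s^N / N! ≤ e^s` with `s = t(c - 2)` gives the other summand. A power bound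
keeps the majorant rational in `t`. -/
lemma exp_neg_mul_sub_two_le {t : ℝ} (ht : 0 < t) (N : ℕ) {c : ℕ} (hc : 2 ≤ c) :
    Real.exp (-(t * (c - 2))) ≤ (2 ^ N + N.factorial * 3 ^ N / t ^ N) * ((c : ℝ) ^ N)⁻¹ := by
  have hc0 : (0 : ℝ) < c := by exact_mod_cast (by omega : 0 < c)
  rw [← div_eq_mul_inv, le_div_iff₀ (by positivity)]
  rcases hc.eq_or_lt with h | h
  · subst h
    have : 0 ≤ (N.factorial : ℝ) * 3 ^ N / t ^ N := by positivity
    simpa using this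
  · have h3 : (3 : ℝ) ≤ c := by exact_mod_cast h
    have h4 : 0 ≤ t * (c - 2) := mul_nonneg ht.le (by linarith)
    have h5 := Real.pow_div_factorial_le_exp _ h4 N
    rw [Real.exp_neg, inv_mul_le_iff₀ (Real.exp_pos _)]
    have h6 : (c : ℝ) ^ N ≤ (t * (c - 2)) ^ N * (3 ^ N / t ^ N) := by
      rw [mul_pow, ← div_pow, mul_comm (t ^ N), mul_assoc, ← mul_pow, mul_div_cancel₀ _ ht.ne',
        ← mul_pow]
      gcongr
      linarith
    calc (c : ℝ) ^ N ≤ (t * (c - 2)) ^ N * (3 ^ N / t ^ N) := h6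
      _ = ((t * (c - 2)) ^ N / N.factorial) * (N.factorial * 3 ^ N / t ^ N) := by
          have : (N.factorial : ℝ) ≠ 0 := by positivity
          field_simp
      _ ≤ Real.exp (t * (c - 2)) * (2 ^ N + N.factorial * 3 ^ N / t ^ N) := by
          gcongr
          exact le_add_of_nonneg_left (by positivity)

/-- The sum of the interactions of all pairs of different nontrivial translates. -/
def crossTotal (m : ℕ) (t : ℝ) : ℝ≥0∞ :=
  ∑' j : Fin m → ℤ, ∑' k : Fin m → ℤ,
    if j ≠ 0 ∧ k ≠ 0 ∧ j ≠ k then ENNReal.ofReal (Real.exp (-(t * crossSum j k))) else 0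

/-- The sum of the majorants over the lattice. -/
def latticeConst (m : ℕ) : ℝ≥0∞ := (∑' n, ENNReal.ofReal (latticeWeight n)) ^ m

lemma latticeConst_ne_top (m : ℕ) : latticeConst m ≠ ∞ :=
  ENNReal.pow_ne_top summable_latticeWeight.tsum_ofReal_ne_top

/-- As the total exponent `c` is at least `2`, `e^{-2t}` can be split off. The rest is bounded by a
multiple of `c^{-4m}`, which provides one factor `c^{-2}` for each of the `2m` coordinates of the
pair, so the double sum factorizes. -/
lemma crossTotal_le (m : ℕ) {t : ℝ} (ht : 0 < t) :
    crossTotal m t ≤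
      ENNReal.ofReal (Real.exp (-(2 * t)) * tailBound m t) * latticeConst m ^ 2 := by
  have hterm : ∀ j k : Fin m → ℤ,
      (if j ≠ 0 ∧ k ≠ 0 ∧ j ≠ k then ENNReal.ofReal (Real.exp (-(t * crossSum j k))) else 0) ≤
      ENNReal.ofReal (Real.exp (-(2 * t)) * tailBound m t) *
        ((∏ i, ENNReal.ofReal (latticeWeight (j i))) *
          ∏ i, ENNReal.ofReal (latticeWeight (k i))) := by
    intro j k
    split_ifs with h
    · have hc := two_le_crossSum h.1 h.2.1 h.2.2
      have hT : 0 ≤ tailBound m t := by unfold tailBound; positivity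
      rw [← ENNReal.ofReal_prod_of_nonneg fun i _ => latticeWeight_nonneg _,
        ← ENNReal.ofReal_prod_of_nonneg fun i _ => latticeWeight_nonneg _,
        ← ENNReal.ofReal_mul (Finset.prod_nonneg fun i _ => latticeWeight_nonneg _),
        ← ENNReal.ofReal_mul (by positivity)]
      refine ENNReal.ofReal_le_ofReal ?_
      have e1 : Real.exp (-(t * crossSum j k)) =
          Real.exp (-(2 * t)) * Real.exp (-(t * (crossSum j k - 2))) := by
        rw [← Real.exp_add]; ring_nf
      have e2 : ((crossSum j k : ℝ) ^ (4 * m))⁻¹ =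
          (∏ _i : Fin m, ((crossSum j k : ℝ) ^ 2)⁻¹) *
            ∏ _i : Fin m, ((crossSum j k : ℝ) ^ 2)⁻¹ := by
        rw [Finset.prod_const, Finset.card_univ, Fintype.card_fin, ← mul_pow, ← mul_inv, ← pow_add,
          inv_pow, ← pow_mul]
      rw [e1, mul_assoc]
      refine mul_le_mul_of_nonneg_left ((exp_neg_mul_sub_two_le ht (4 * m) hc).trans ?_)
        (Real.exp_nonneg _)
      refine mul_le_mul_of_nonneg_left ?_ hT
      rw [e2]
      refine mul_le_mul ?_ ?_ (Finset.prod_nonneg fun _ _ => by positivity)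
        (Finset.prod_nonneg fun _ _ => latticeWeight_nonneg _)
      · exact Finset.prod_le_prod (fun _ _ => by positivity) fun i _ =>
          inv_sq_le_latticeWeight (by omega)
            ((natAbs_le_crossExp_left _ _).trans (crossExp_le_crossSum j k i))
      · exact Finset.prod_le_prod (fun _ _ => by positivity) fun i _ =>
          inv_sq_le_latticeWeight (by omega)
            ((natAbs_le_crossExp_right _ _).trans (crossExp_le_crossSum j k i))
    · exact zero_le
  calc crossTotal m t ≤ ∑' j : Fin m → ℤ, ∑' k : Fin m → ℤ,
      ENNReal.ofReal (Real.exp (-(2 * t)) * tailBound m t) *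
        ((∏ i, ENNReal.ofReal (latticeWeight (j i))) *
          ∏ i, ENNReal.ofReal (latticeWeight (k i))) :=
        ENNReal.tsum_le_tsum fun j => ENNReal.tsum_le_tsum fun k => hterm j k
    _ = _ := by
      simp only [ENNReal.tsum_mul_left, ENNReal.tsum_mul_right,
        tsum_pi_prod fun n => ENNReal.ofReal (latticeWeight n)]
      rw [← latticeConst, sq]

end Lattice

/-! ### The tiling of `ℝ^m` by translates of the cube -/

section Tiling

variable {m : ℕ}

/-- The translate of the half-open cube by `2dj`. -/
def tile (m : ℕ) (d : ℝ) (j : Fin m → ℤ) : Set (RR m) := (fun x => x - shift d j) ⁻¹' cubeIoc m d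

lemma measurableSet_tile (d : ℝ) (j : Fin m → ℤ) : MeasurableSet (tile m d j) :=
  (measurable_id.sub_const _) (measurableSet_cubeIoc m d)

lemma mem_tile_iff {d : ℝ} {j : Fin m → ℤ} {x : RR m} :
    x ∈ tile m d j ↔ ∀ i, x i - j i • (2 * d) ∈ Set.Ioc (-d) (-d + 2 * d) := by
  have : -d + 2 * d = d := by ring
  simp only [tile, cubeIoc, Set.mem_preimage, Set.mem_ofPred_eq, PiLp.sub_apply, shift_apply,
    zsmul_eq_mul, this, mul_comm (2 * d)]

lemma iUnion_tile {d : ℝ} (hd : 0 < d) : ⋃ j, tile m d j = Set.univ := by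
  refine Set.eq_univ_of_forall fun x => Set.mem_iUnion.2 ?_
  choose j hj using fun i => (existsUnique_sub_zsmul_mem_Ioc
    (by positivity : 0 < 2 * d) (x i) (-d)).exists
  exact ⟨j, mem_tile_iff.2 hj⟩

lemma pairwise_disjoint_tile {d : ℝ} (hd : 0 < d) :
    Pairwise (Function.onFun Disjoint (tile m d)) := by
  intro j k hjk
  refine Set.disjoint_left.2 fun x hj hk => hjk ?_
  funext i
  exact (existsUnique_sub_zsmul_mem_Ioc (by positivity : 0 < 2 * d) (x i) (-d)).unique
    (mem_tile_iff.1 hj i) (mem_tile_iff.1 hk i)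

lemma tile_zero (d : ℝ) : tile m d 0 = cubeIoc m d := by
  have : shift d (0 : Fin m → ℤ) = 0 := by ext i; simp [shift_apply]
  simp [tile, this]

lemma setIntegral_tile {E : Type*} [NormedAddCommGroup E] [NormedSpace ℝ E] (d : ℝ)
    (j : Fin m → ℤ) (F : RR m → E) :
    ∫ x in tile m d j, F x = ∫ x in cube m d, F (x + shift d j) := by
  have := (measurePreserving_sub_right (volume : Measure (RR m))
    (shift d j)).setIntegral_preimage_emb (MeasurableEquiv.subRight (shift d j)).measurableEmbedding
    (fun x => F (x + shift d j)) (cubeIoc m d)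
  simp only [sub_add_cancel] at this
  rw [setIntegral_congr_set (cube_ae_eq_cubeIoc m d), ← this, tile]

lemma setLIntegral_tile (d : ℝ) (j : Fin m → ℤ) (F : RR m → ℝ≥0∞) :
    ∫⁻ x in tile m d j, F x = ∫⁻ x in cube m d, F (x + shift d j) := by
  have := (measurePreserving_sub_right (volume : Measure (RR m))
    (shift d j)).setLIntegral_comp_preimage_emb
    (MeasurableEquiv.subRight (shift d j)).measurableEmbedding
    (fun x => F (x + shift d j)) (cubeIoc m d)
  simp only [sub_add_cancel] at this
  rw [setLIntegral_congr (cube_ae_eq_cubeIoc m d), ← this, tile]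

lemma hasSum_setIntegral_shift {E : Type*} [NormedAddCommGroup E] [NormedSpace ℝ E]
    [CompleteSpace E] {d : ℝ} (hd : 0 < d) {F : RR m → E} (hF : Integrable F) :
    HasSum (fun j => ∫ x in cube m d, F (x + shift d j)) (∫ x, F x) := by
  have := hasSum_integral_iUnion (measurableSet_tile d) (pairwise_disjoint_tile (m := m) hd)
    hF.integrableOn
  simpa only [setIntegral_tile, iUnion_tile hd, Measure.restrict_univ] using this

/-- The tiles other than the central one are disjoint and lie outside of the central one. This is
how the diagonal terms of the inner error become the outer error. -/
lemma tsum_setLIntegral_shift_le {d : ℝ} (hd : 0 < d) (F : RR m → ℝ≥0∞) :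
    ∑' j : Fin m → ℤ, (if j = 0 then 0 else ∫⁻ x in cube m d, F (x + shift d j)) ≤
      ∫⁻ x in (cube m d)ᶜ, F x := by
  have h1 : ∫⁻ x in (cube m d)ᶜ, F x = ∫⁻ x in (cubeIoc m d)ᶜ, F x :=
    setLIntegral_congr (cube_ae_eq_cubeIoc m d).compl
  have h2 : ∫⁻ x in (cubeIoc m d)ᶜ, F x =
      ∑' j : Fin m → ℤ, ∫⁻ x in tile m d j, (cubeIoc m d)ᶜ.indicator F x := by
    rw [← lintegral_indicator (measurableSet_cubeIoc m d).compl,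
      ← lintegral_iUnion (measurableSet_tile d) (pairwise_disjoint_tile hd), iUnion_tile hd,
      Measure.restrict_univ]
  rw [h1, h2]
  refine ENNReal.tsum_le_tsum fun j => ?_
  split_ifs with hj
  · exact zero_le
  · rw [← setLIntegral_tile]
    refine (setLIntegral_congr_fun (measurableSet_tile d j) fun x hx => ?_).le
    have : x ∉ cubeIoc m d := by
      rw [← tile_zero]
      exact Set.disjoint_left.1 (pairwise_disjoint_tile hd hj) hx
    rw [Set.indicator_of_mem this]

end Tiling

/-! ### Estimates of the convolution -/

section Estimates

variable {m : ℕ}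

lemma lintegral_mul_sq_le {X : Type*} [MeasurableSpace X] {μ : Measure X} {f g : X → ℝ≥0∞}
    (hf : AEMeasurable f μ) (hg : AEMeasurable g μ) :
    (∫⁻ x, f x * g x ∂μ) ^ 2 ≤ (∫⁻ x, f x ^ 2 ∂μ) * ∫⁻ x, g x ^ 2 ∂μ := by
  have h := ENNReal.lintegral_mul_le_Lp_mul_Lq μ Real.HolderConjugate.two_two hf hg
  simp only [ENNReal.rpow_two, Pi.mul_apply] at h
  calc (∫⁻ x, f x * g x ∂μ) ^ 2
      ≤ ((∫⁻ x, f x ^ 2 ∂μ) ^ (1 / 2 : ℝ) * (∫⁻ x, g x ^ 2 ∂μ) ^ (1 / 2 : ℝ)) ^ 2 := by gcongr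
    _ = _ := by
      rw [mul_pow, ← ENNReal.rpow_two, ← ENNReal.rpow_two, ← ENNReal.rpow_mul, ← ENNReal.rpow_mul]
      norm_num

lemma ofReal_norm_sq_eq_lintegral (f : L2 m) :
    ENNReal.ofReal (‖f‖ ^ 2) = ∫⁻ x, ‖f x‖ₑ ^ 2 := by
  rw [Lp.norm_def, ENNReal.ofReal_pow ENNReal.toReal_nonneg,
    ENNReal.ofReal_toReal (Lp.eLpNorm_ne_top f),
    eLpNorm_eq_lintegral_rpow_enorm_toReal (by norm_num) (by norm_num)]
  rw [← ENNReal.rpow_two, ← ENNReal.rpow_mul]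
  norm_num

lemma opNorm_sq_le {T : L2 m →L[ℂ] L2 m} {K : ℝ} (hK : 0 ≤ K)
    (h : ∀ u, ‖T u‖ ^ 2 ≤ K * ‖u‖ ^ 2) : ‖T‖ ^ 2 ≤ K := by
  have : ‖T‖ ≤ Real.sqrt K := by
    refine T.opNorm_le_bound (Real.sqrt_nonneg _) fun u => ?_
    refine abs_le_of_sq_le_sq' ?_ (by positivity) |>.2
    rw [mul_pow, Real.sq_sqrt hK]
    exact h u
  calc ‖T‖ ^ 2 ≤ Real.sqrt K ^ 2 := by gcongr
    _ = K := Real.sq_sqrt hK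

lemma enorm_convFun_le {k g : RR m → ℂ} {a C d : ℝ}
    (hk : ∀ x, ‖k x‖ ≤ C * Real.exp (-(a * ∑ i, |x i|)))
    (hg : ∀ᵐ x, x ∉ cube m d → g x = 0) (x : RR m) :
    ‖convFun k g x‖ₑ ≤ ∫⁻ y in cube m d,
      ENNReal.ofReal (C * Real.exp (-(a * ∑ i, |(x - y) i|))) * ‖g y‖ₑ := by
  have h : convFun k g x = ∫ y in cube m d, k (x - y) * g y := by
    rw [convFun, ← integral_indicator (measurableSet_cube m d)]
    refine integral_congr_ae ?_
    filter_upwards [hg] with y hy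
    by_cases hc : y ∈ cube m d
    · rw [Set.indicator_of_mem hc]
    · rw [Set.indicator_of_notMem hc, hy hc, mul_zero]
  rw [h]
  refine (enorm_integral_le_lintegral_enorm _).trans (lintegral_mono fun y => ?_)
  rw [enorm_mul]
  gcongr
  rw [← ofReal_norm]
  exact ENNReal.ofReal_le_ofReal (hk _)

/-- The Hilbert-Schmidt bound of the convolution outside of the cube. -/
lemma lintegral_compl_cube_convFun_le {k v u : RR m → ℂ} {a C d B : ℝ} (ha : 0 < a) (hC : 0 ≤ C)
    (hk : ∀ x, ‖k x‖ ≤ C * Real.exp (-(a * ∑ i, |x i|)))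
    (hv : Continuous v) (hB : ∀ x, ‖v x‖ ≤ B) (hu : Measurable u)
    (hg : ∀ᵐ x, x ∉ cube m d → v x * u x = 0) :
    ∫⁻ x in (cube m d)ᶜ, ‖convFun k (fun y => v y * u y) x‖ₑ ^ 2 ≤
      ENNReal.ofReal (Real.exp (-(2 * a * d)) * (C ^ 2 / a ^ m) *
        ∫ y in cube m d, ‖v y‖ ^ 2 * e1 a d y) * ∫⁻ y, ‖u y‖ₑ ^ 2 := by
  set ω : RR m → ℝ := fun z => C * Real.exp (-(a * ∑ i, |z i|)) with hω
  have hωc : Continuous ω := by simp only [hω]; fun_prop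
  -- In Cauchy-Schwarz the function `v` stays with the kernel, and only `u` is split off.
  have hpt : ∀ x, ‖convFun k (fun y => v y * u y) x‖ₑ ^ 2 ≤
      (∫⁻ y in cube m d, ENNReal.ofReal (ω (x - y)) ^ 2 * ‖v y‖ₑ ^ 2) * ∫⁻ y, ‖u y‖ₑ ^ 2 := by
    intro x
    have h1 := enorm_convFun_le hk hg x
    simp only [enorm_mul, ← mul_assoc] at h1
    have h2 := lintegral_mul_sq_le (μ := volume.restrict (cube m d))
      (f := fun y => ENNReal.ofReal (ω (x - y)) * ‖v y‖ₑ) (g := fun y => ‖u y‖ₑ)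
      (by fun_prop) (by fun_prop)
    refine (pow_le_pow_left' h1 2).trans (h2.trans ?_)
    simp only [mul_pow]
    gcongr
    exact Measure.restrict_le_self
  have hmeas : Measurable fun x : RR m =>
      ∫⁻ y in cube m d, ENNReal.ofReal (ω (x - y)) ^ 2 * ‖v y‖ₑ ^ 2 := by
    refine Measurable.lintegral_prod_right' (f := fun p : RR m × RR m =>
      ENNReal.ofReal (ω (p.1 - p.2)) ^ 2 * ‖v p.2‖ₑ ^ 2) ?_
    exact ((hωc.measurable.comp (measurable_fst.sub measurable_snd)).ennreal_ofReal.pow_const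
      2).mul ((hv.measurable.comp measurable_snd).enorm.pow_const 2)
  calc ∫⁻ x in (cube m d)ᶜ, ‖convFun k (fun y => v y * u y) x‖ₑ ^ 2
      ≤ ∫⁻ x in (cube m d)ᶜ, (∫⁻ y in cube m d,
          ENNReal.ofReal (ω (x - y)) ^ 2 * ‖v y‖ₑ ^ 2) * ∫⁻ y, ‖u y‖ₑ ^ 2 :=
        lintegral_mono fun x => hpt x
    _ = (∫⁻ x in (cube m d)ᶜ, ∫⁻ y in cube m d,
          ENNReal.ofReal (ω (x - y)) ^ 2 * ‖v y‖ₑ ^ 2) * ∫⁻ y, ‖u y‖ₑ ^ 2 :=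
        lintegral_mul_const _ hmeas
    _ = (∫⁻ y in cube m d, ∫⁻ x in (cube m d)ᶜ,
          ENNReal.ofReal (ω (x - y)) ^ 2 * ‖v y‖ₑ ^ 2) * ∫⁻ y, ‖u y‖ₑ ^ 2 := by
        rw [lintegral_lintegral_swap]
        simp only [Function.uncurry_def]
        fun_prop
    _ = _ := ?_
  congr 1
  -- Squaring the kernel bound doubles the rate, so the exact formula with exponent `2a` applies.
  have hin : ∀ y ∈ cube m d, ∫⁻ x in (cube m d)ᶜ,
      ENNReal.ofReal (ω (x - y)) ^ 2 * ‖v y‖ₑ ^ 2 =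
      ENNReal.ofReal (Real.exp (-(2 * a * d)) * (C ^ 2 / a ^ m) * (‖v y‖ ^ 2 * e1 a d y)) := by
    intro y hy
    have hsq : ∀ x, ω (x - y) ^ 2 = C ^ 2 * Real.exp (-(2 * a * ∑ i, |x i - y i|)) := by
      intro x
      simp only [hω, mul_pow, ← Real.exp_nat_mul, PiLp.sub_apply]
      congr 2; push_cast; ring
    have hω0 : ∀ z, 0 ≤ ω z := fun z => mul_nonneg hC (Real.exp_nonneg _)
    rw [lintegral_mul_const _ (by fun_prop)]
    simp only [← ENNReal.ofReal_pow (hω0 _), hsq]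
    rw [← ofReal_integral_eq_lintegral_ofReal
      ((integrable_exp_neg_mul_sum (by positivity) y).const_mul _).integrableOn
      (.of_forall fun x => by positivity), integral_const_mul, setIntegral_compl_cube_exp ha hy,
      ← ofReal_norm, ← ENNReal.ofReal_pow (norm_nonneg _), ← ENNReal.ofReal_mul
      (by have := e1_nonneg ha hy; positivity)]
    congr 1
    ring
  rw [setLIntegral_congr_fun (measurableSet_cube m d) hin, ← integral_const_mul,
    ofReal_integral_eq_lintegral_ofReal]
  · refine Integrable.const_mul ?_ _
    have hb : ∀ y ∈ cube m d, e1 a d y ≤ m * Real.cosh (2 * a * d) := fun y hy =>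
      e1_le ha le_rfl hy
    refine Measure.integrableOn_of_bounded (M := B ^ 2 * (m * Real.cosh (2 * a * d)))
      (volume_cube_lt_top m d).ne
      ((hv.norm.pow 2).mul (continuous_e1 a d)).aestronglyMeasurable ?_
    refine (ae_restrict_iff' (measurableSet_cube m d)).2 (.of_forall fun y hy => ?_)
    have h0 := e1_nonneg ha hy
    rw [Real.norm_of_nonneg (by positivity)]
    have := hb y hy
    have := hB y
    gcongr
  · refine (ae_restrict_iff' (measurableSet_cube m d)).2 (.of_forall fun y hy => ?_)
    have := e1_nonneg ha hy
    simp only [Pi.zero_apply]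
    positivity

/-- The sum of the norms of the nontrivial translates. -/
def shiftSum (d : ℝ) (w : RR m → ℂ) (x : RR m) : ℝ≥0∞ :=
  ∑' j : Fin m → ℤ, if j = 0 then 0 else ‖w (x + shift d j)‖ₑ

/-- The product of the two convolutions is a double integral over `(y, z)`. By `crossSum_le_dist`
its kernel is at most `C² e^{-2ad c} e^{a|y|₁} e^{a|z|₁}`, which separates the variables and no
longer depends on `x`. -/
lemma enorm_convFun_shift_mul_le {k g : RR m → ℂ} {a C d : ℝ} (ha : 0 < a) (hC : 0 ≤ C)
    (hk : ∀ x, ‖k x‖ ≤ C * Real.exp (-(a * ∑ i, |x i|))) (hgm : AEMeasurable g)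
    (hg : ∀ᵐ x, x ∉ cube m d → g x = 0) {x : RR m} (hx : x ∈ cube m d) (j l : Fin m → ℤ) :
    ‖convFun k g (x + shift d j)‖ₑ * ‖convFun k g (x + shift d l)‖ₑ ≤
      ENNReal.ofReal (C ^ 2) * ENNReal.ofReal (Real.exp (-(2 * a * d * crossSum j l))) *
      (∫⁻ y in cube m d, ENNReal.ofReal (Real.exp (a * ∑ i, |y i|)) * ‖g y‖ₑ) ^ 2 := by
  set ρ : RR m → ℝ≥0∞ := fun y => ENNReal.ofReal (Real.exp (a * ∑ i, |y i|)) with hρ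
  have hρm : Measurable ρ := by simp only [hρ]; fun_prop
  have hgm' : AEMeasurable (fun y => ‖g y‖ₑ) (volume.restrict (cube m d)) :=
    hgm.enorm.restrict
  set c : ℝ≥0∞ := ENNReal.ofReal (C ^ 2) *
    ENNReal.ofReal (Real.exp (-(2 * a * d * crossSum j l))) with hc
  have hker : ∀ y z : RR m,
      ENNReal.ofReal (C * Real.exp (-(a * ∑ i, |(x + shift d j - y) i|))) *
        ENNReal.ofReal (C * Real.exp (-(a * ∑ i, |(x + shift d l - z) i|))) ≤
      c * (ρ y * ρ z) := by
    intro y z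
    rw [hc, ← ENNReal.ofReal_mul (by positivity), ← ENNReal.ofReal_mul (by positivity),
      ← ENNReal.ofReal_mul (by positivity), ← ENNReal.ofReal_mul (by positivity)]
    refine ENNReal.ofReal_le_ofReal ?_
    have h := crossSum_le_dist hx y z j l
    rw [mul_mul_mul_comm, ← sq, mul_assoc, ← Real.exp_add, ← Real.exp_add, ← Real.exp_add]
    refine mul_le_mul_of_nonneg_left (Real.exp_le_exp.2 ?_) (by positivity)
    have := mul_le_mul_of_nonneg_left h ha.le
    linarith
  calc ‖convFun k g (x + shift d j)‖ₑ * ‖convFun k g (x + shift d l)‖ₑ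
      ≤ (∫⁻ y in cube m d,
          ENNReal.ofReal (C * Real.exp (-(a * ∑ i, |(x + shift d j - y) i|))) * ‖g y‖ₑ) *
        ∫⁻ z in cube m d,
          ENNReal.ofReal (C * Real.exp (-(a * ∑ i, |(x + shift d l - z) i|))) * ‖g z‖ₑ :=
        mul_le_mul' (enorm_convFun_le hk hg _) (enorm_convFun_le hk hg _)
    _ = ∫⁻ y in cube m d, ∫⁻ z in cube m d,
          (ENNReal.ofReal (C * Real.exp (-(a * ∑ i, |(x + shift d j - y) i|))) * ‖g y‖ₑ) *
          (ENNReal.ofReal (C * Real.exp (-(a * ∑ i, |(x + shift d l - z) i|))) * ‖g z‖ₑ) := by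
        rw [lintegral_lintegral_mul] <;> fun_prop
    _ ≤ ∫⁻ y in cube m d, ∫⁻ z in cube m d, c * ((ρ y * ‖g y‖ₑ) * (ρ z * ‖g z‖ₑ)) := by
        refine lintegral_mono fun y => lintegral_mono fun z => ?_
        rw [mul_mul_mul_comm, mul_mul_mul_comm (ρ y), ← mul_assoc c]
        exact mul_le_mul' (hker y z) le_rfl
    _ = c * (∫⁻ y in cube m d, ρ y * ‖g y‖ₑ) ^ 2 := by
        rw [sq, ← lintegral_lintegral_mul (by fun_prop) (by fun_prop)]
        have hcne : c ≠ ∞ := ENNReal.mul_ne_top ENNReal.ofReal_ne_top ENNReal.ofReal_ne_top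
        simp only [lintegral_const_mul' _ _ hcne]

/-- The square is a double sum over nonzero `j` and `l`. The terms with `j = l` unfold to the
complement of the cube; the others are bounded uniformly in `x`, so their integral costs only the
volume. Extended nonnegative values make every interchange free. -/
lemma lintegral_cube_shiftSum_sq_le {k g : RR m → ℂ} {a C d : ℝ} (ha : 0 < a) (hd : 0 < d)
    (hC : 0 ≤ C) (hk : ∀ x, ‖k x‖ ≤ C * Real.exp (-(a * ∑ i, |x i|)))
    (hw : AEMeasurable (convFun k g)) (hgm : AEMeasurable g)
    (hg : ∀ᵐ x, x ∉ cube m d → g x = 0) :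
    ∫⁻ x in cube m d, shiftSum d (convFun k g) x ^ 2 ≤
      (∫⁻ x in (cube m d)ᶜ, ‖convFun k g x‖ₑ ^ 2) +
      ENNReal.ofReal (C ^ 2) * crossTotal m (2 * a * d) *
      (∫⁻ y in cube m d, ENNReal.ofReal (Real.exp (a * ∑ i, |y i|)) * ‖g y‖ₑ) ^ 2 *
        volume (cube m d) := by
  set w := convFun k g
  set R := (∫⁻ y in cube m d, ENNReal.ofReal (Real.exp (a * ∑ i, |y i|)) * ‖g y‖ₑ) ^ 2 with hR
  have hpt : ∀ x ∈ cube m d, shiftSum d w x ^ 2 ≤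
      (∑' j : Fin m → ℤ, if j = 0 then 0 else ‖w (x + shift d j)‖ₑ ^ 2) +
        ENNReal.ofReal (C ^ 2) * crossTotal m (2 * a * d) * R := by
    intro x hx
    rw [shiftSum, sq, ← ENNReal.tsum_mul_right]
    simp only [← ENNReal.tsum_mul_left]
    have hterm : ∀ j l : Fin m → ℤ, (if j = 0 then 0 else ‖w (x + shift d j)‖ₑ) *
        (if l = 0 then 0 else ‖w (x + shift d l)‖ₑ) ≤
        (if l = j then (if j = 0 then 0 else ‖w (x + shift d j)‖ₑ ^ 2) else 0) +
        ENNReal.ofReal (C ^ 2) * (if j ≠ 0 ∧ l ≠ 0 ∧ j ≠ l then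
          ENNReal.ofReal (Real.exp (-(2 * a * d * crossSum j l))) else 0) * R := by
      intro j l
      by_cases hj : j = 0
      · simp [hj]
      by_cases hl : l = 0
      · simp [hl]
      by_cases hjl : j = l
      · subst hjl
        simp [hj, sq]
      · simp only [hj, hl, hjl, Ne.symm hjl, if_false, not_false_eq_true, ne_eq, and_self, if_true,
          zero_add]
        exact enorm_convFun_shift_mul_le ha hC hk hgm hg hx j l
    calc _ ≤ _ := ENNReal.tsum_le_tsum fun j => ENNReal.tsum_le_tsum fun l => hterm j l
      _ = _ := by
        simp only [ENNReal.tsum_add, ENNReal.tsum_mul_left, ENNReal.tsum_mul_right, tsum_ite_eq,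
          crossTotal]
  calc ∫⁻ x in cube m d, shiftSum d w x ^ 2
      ≤ ∫⁻ x in cube m d, ((∑' j : Fin m → ℤ, if j = 0 then 0 else ‖w (x + shift d j)‖ₑ ^ 2) +
        ENNReal.ofReal (C ^ 2) * crossTotal m (2 * a * d) * R) :=
        setLIntegral_mono' (measurableSet_cube m d) hpt
    _ = (∑' j : Fin m → ℤ,
          if j = 0 then 0 else ∫⁻ x in cube m d, ‖w (x + shift d j)‖ₑ ^ 2) +
        ENNReal.ofReal (C ^ 2) * crossTotal m (2 * a * d) * R * volume (cube m d) := by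
        rw [lintegral_add_right _ measurable_const, setLIntegral_const, lintegral_tsum]
        · congr 2
          funext j
          split_ifs <;> simp
        · intro j
          split_ifs
          · exact aemeasurable_const
          · exact ((hw.comp_quasiMeasurePreserving
              (measurePreserving_add_right volume (shift d j)).quasiMeasurePreserving).enorm.pow_const
                2).restrict
    _ ≤ _ := by
        gcongr
        exact tsum_setLIntegral_shift_le hd fun x => ‖w x‖ₑ ^ 2

/-- In each coordinate `e^{2a|t|} ≤ 2 cosh(2at)`, whence the factor `2^m`. -/
lemma exp_two_mul_sum_abs_le (a : ℝ) (y : RR m) :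
    Real.exp (a * ∑ i, |y i|) ^ 2 ≤ 2 ^ m * e2 a y := by
  rw [← Real.exp_nat_mul, ← mul_assoc, Finset.mul_sum, Real.exp_sum, e2]
  calc _ ≤ ∏ i, (2 * Real.cosh (2 * a * y i)) := by
        refine Finset.prod_le_prod (fun _ _ => Real.exp_nonneg _) fun i _ => ?_
        rw [Real.cosh_eq]
        have h1 := Real.exp_pos (2 * a * y i)
        have h2 := Real.exp_pos (-(2 * a * y i))
        push_cast
        rcases abs_cases (y i) with ⟨h, -⟩ | ⟨h, -⟩ <;> rw [h]
        · linarith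
        · rw [mul_neg]; linarith
    _ = _ := by simp [Finset.prod_mul_distrib]

/-- The Cauchy-Schwarz bound of the weighted mass of `v u`. -/
lemma lintegral_exp_mul_sq_le {v u : RR m → ℂ} {a d B : ℝ}
    (hv : Continuous v) (hB : ∀ x, ‖v x‖ ≤ B) (hu : Measurable u) :
    (∫⁻ y in cube m d, ENNReal.ofReal (Real.exp (a * ∑ i, |y i|)) * ‖v y * u y‖ₑ) ^ 2 ≤
      ENNReal.ofReal (2 ^ m * ∫ y in cube m d, ‖v y‖ ^ 2 * e2 a y) * ∫⁻ y, ‖u y‖ₑ ^ 2 := by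
  simp only [enorm_mul, ← mul_assoc]
  refine (lintegral_mul_sq_le (by fun_prop) (by fun_prop)).trans ?_
  gcongr
  · rw [← integral_const_mul, ofReal_integral_eq_lintegral_ofReal]
    · refine lintegral_mono fun y => ?_
      rw [← ofReal_norm, ← ENNReal.ofReal_mul (by positivity),
        ← ENNReal.ofReal_pow (by positivity)]
      refine ENNReal.ofReal_le_ofReal ?_
      rw [mul_pow]
      have := mul_le_mul_of_nonneg_right (exp_two_mul_sum_abs_le a y) (sq_nonneg ‖v y‖)
      linarith
    · refine Integrable.const_mul ?_ _
      refine Measure.integrableOn_of_bounded (M := B ^ 2 * Real.cosh (2 * a * d) ^ m)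
        (volume_cube_lt_top m d).ne
        ((hv.norm.pow 2).mul (continuous_e2 a)).aestronglyMeasurable ?_
      refine (ae_restrict_iff' (measurableSet_cube m d)).2 (.of_forall fun y hy => ?_)
      have h0 := (e2_pos a y).le
      rw [Real.norm_of_nonneg (by positivity)]
      have := e2_le (a := a) hy
      have := hB y
      gcongr
    · refine .of_forall fun y => ?_
      have := (e2_pos a y).le
      simp only [Pi.zero_apply]
      positivity
  · exact Measure.restrict_le_self

end Estimates

/-! ### The operator `𝕂_α` as a periodization -/

section Periodization

variable {m : ℕ}

/-- The sum of the nontrivial translates. -/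
def shiftTsum (d : ℝ) (w : RR m → ℂ) (x : RR m) : ℂ :=
  ∑' j : Fin m → ℤ, if j = 0 then 0 else w (x + shift d j)

lemma shift_zero (d : ℝ) : shift d (0 : Fin m → ℤ) = 0 := by
  ext i; simp [shift_apply]

lemma enorm_shift_ite (d : ℝ) (w : RR m → ℂ) (x : RR m) (j : Fin m → ℤ) :
    ‖(if j = 0 then 0 else w (x + shift d j) : ℂ)‖ₑ =
      if j = 0 then 0 else ‖w (x + shift d j)‖ₑ := by
  split_ifs <;> simp

lemma enorm_shiftTsum_le (d : ℝ) (w : RR m → ℂ) (x : RR m) :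
    ‖shiftTsum d w x‖ₑ ≤ shiftSum d w x := by
  refine enorm_tsum_le_tsum_enorm.trans_eq ?_
  simp only [enorm_shift_ite, shiftSum]

lemma summable_shift_of_ne_top {d : ℝ} {w : RR m → ℂ} {x : RR m} (h : shiftSum d w x ≠ ∞) :
    Summable fun j : Fin m → ℤ => (if j = 0 then 0 else w (x + shift d j) : ℂ) := by
  refine Summable.of_norm (tsum_enorm_ne_top_iff_summable_norm.1 ?_)
  simpa only [enorm_shift_ite, shiftSum] using h

lemma aestronglyMeasurable_comp_shift {w : RR m → ℂ} (hw : AEStronglyMeasurable w) (d : ℝ)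
    (j : Fin m → ℤ) : AEStronglyMeasurable (fun x => w (x + shift d j)) :=
  hw.comp_quasiMeasurePreserving
    (measurePreserving_add_right volume (shift d j)).quasiMeasurePreserving

/-- Finiteness of the integral gives absolute convergence of the periodization at almost every point
of the cube, and with it the measurability and the termwise manipulation of `shiftTsum`. -/
lemma ae_shiftSum_ne_top {d : ℝ} {w : RR m → ℂ} (hw : AEStronglyMeasurable w)
    (h : ∫⁻ x in cube m d, shiftSum d w x ^ 2 ≠ ∞) :
    ∀ᵐ x ∂(volume.restrict (cube m d)), shiftSum d w x ≠ ∞ := by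
  have hm : AEMeasurable (fun x => shiftSum d w x ^ 2) (volume.restrict (cube m d)) := by
    refine (AEMeasurable.tsum fun j => ?_).pow_const 2
    split_ifs
    · exact aemeasurable_const
    · exact (aestronglyMeasurable_comp_shift hw d j).enorm.restrict
  filter_upwards [ae_lt_top' hm h] with x hx h'
  rw [h'] at hx
  simp at hx

lemma aestronglyMeasurable_shiftTsum {d : ℝ} {w : RR m → ℂ} (hw : AEStronglyMeasurable w)
    (h : ∫⁻ x in cube m d, shiftSum d w x ^ 2 ≠ ∞) :
    AEStronglyMeasurable (shiftTsum d w) (volume.restrict (cube m d)) := by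
  refine aestronglyMeasurable_of_tendsto_ae Filter.atTop
    (f := fun (s : Finset (Fin m → ℤ)) x => ∑ j ∈ s, if j = 0 then 0 else w (x + shift d j))
    (fun s => ?_) ?_
  · refine Finset.aestronglyMeasurable_fun_sum _ fun j _ => ?_
    split_ifs
    · exact aestronglyMeasurable_const
    · exact (aestronglyMeasurable_comp_shift hw d j).restrict
  · filter_upwards [ae_shiftSum_ne_top hw h] with x hx
    exact (summable_shift_of_ne_top hx).hasSum

lemma memLp_shiftTsum {d : ℝ} {w : RR m → ℂ} (hw : AEStronglyMeasurable w)
    (h : ∫⁻ x in cube m d, shiftSum d w x ^ 2 ≠ ∞) :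
    MemLp ((cube m d).indicator (shiftTsum d w)) 2 (volume : Measure (RR m)) := by
  rw [memLp_indicator_iff_restrict (measurableSet_cube m d)]
  refine ⟨aestronglyMeasurable_shiftTsum hw h, ?_⟩
  rw [eLpNorm_lt_top_iff_lintegral_rpow_enorm_lt_top (by norm_num) (by norm_num)]
  refine lt_of_le_of_lt (lintegral_mono fun x => ?_) (lt_top_iff_ne_top.2 h)
  rw [ENNReal.toReal_ofNat, ENNReal.rpow_two]
  exact pow_le_pow_left' (enorm_shiftTsum_le d w x) 2

/-- The shift adds `2πi n·j` to the phase, with `n·j` an integer. -/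
lemma exp_phase_add_shift {d : ℝ} (hd : 0 < d) (n j : Fin m → ℤ) (x : RR m) :
    Complex.exp (-phase d n (x + shift d j)) = Complex.exp (-phase d n x) := by
  have h1 : phase d n (x + shift d j) =
      phase d n x + ((∑ i, n i * j i : ℤ) : ℂ) * (2 * Real.pi * Complex.I) := by
    have : ∑ i, (n i : ℝ) / (2 * d) * (x + shift d j) i =
        ∑ i, (n i : ℝ) / (2 * d) * x i + ∑ i, (n i : ℝ) * j i := by
      rw [← Finset.sum_add_distrib]
      refine Finset.sum_congr rfl fun i _ => ?_
      rw [PiLp.add_apply, shift_apply]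
      field_simp
    simp only [phase, this]
    push_cast
    ring
  rw [h1, neg_add, ← neg_mul, ← Int.cast_neg]
  exact Complex.exp_periodic.int_mul _ _

lemma fourier_tilde (w : RR m → ℂ) (d : ℝ) (n : Fin m → ℤ) :
    𝓕 w (tilde d n) = ∫ x, w x * Complex.exp (-phase d n x) := by
  rw [Real.fourier_eq']
  refine integral_congr_ae (.of_forall fun x => ?_)
  simp only [smul_eq_mul, mul_comm (w x)]
  congr 2
  rw [phase, PiLp.inner_apply]
  simp only [tilde, RCLike.inner_apply, conj_trivial]
  push_cast
  ring

/-- The Fourier coefficients of a periodization. -/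
lemma fourierSeries_add_shiftTsum {d : ℝ} (hd : 0 < d) {w : RR m → ℂ} (hw : Integrable w)
    (h : ∫⁻ x in cube m d, shiftSum d w x ^ 2 ≠ ∞) (n : Fin m → ℤ) :
    fourierSeries d (fun x => w x + shiftTsum d w x) n =
      (((volume.real (cube m d))⁻¹ : ℝ) : ℂ) * 𝓕 w (tilde d n) := by
  set F : RR m → ℂ := fun x => w x * Complex.exp (-phase d n x) with hF
  have hnorm : ∀ x, ‖F x‖ = ‖w x‖ := fun x => by
    simp only [hF]
    rw [norm_mul, Complex.exp_neg, norm_inv, norm_exp_phase, inv_one, mul_one]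
  have hFm : AEStronglyMeasurable F := hw.1.mul
    (Complex.continuous_exp.comp (continuous_phase d n).neg).aestronglyMeasurable
  have hFi : Integrable F := hw.norm.mono' hFm (.of_forall fun x => (hnorm x).le)
  have h1 := hasSum_setIntegral_shift hd hFi
  have h2 := hasSum_setIntegral_shift hd hFi.norm
  -- Unfolding as in Poisson summation: the integral over space is the sum over the tiles, and
  -- summability of the integrated norms allows the sum to enter the integral over the cube.
  have h3 := hasSum_integral_of_summable_integral_norm (μ := volume.restrict (cube m d))
    (F := fun (j : Fin m → ℤ) x => F (x + shift d j))
    (fun j => (hFi.comp_add_right (shift d j)).integrableOn) h2.summable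
  rw [fourierSeries, fourier_tilde]
  congr 1
  rw [h1.unique h3]
  refine integral_congr_ae ?_
  filter_upwards [ae_shiftSum_ne_top hw.1 h] with x hx
  have hs := summable_shift_of_ne_top hx
  have hs' : Summable fun j : Fin m → ℤ => w (x + shift d j) := by
    refine (hs.add (hasSum_ite_eq (0 : Fin m → ℤ) (w x)).summable).congr fun j => ?_
    by_cases hj : j = 0
    · simp [hj, shift_zero]
    · simp [hj]
  simp only [hF, exp_phase_add_shift hd]
  rw [tsum_mul_right, hs'.tsum_eq_add_tsum_ite 0, shift_zero, add_zero, shiftTsum]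

end Periodization

/-! ### The bounds of the error operators -/

section Bounds

variable {m : ℕ}

lemma norm_sq_of_ae_eq_indicator {f : L2 m} {s : Set (RR m)} (hs : MeasurableSet s)
    {w : RR m → ℂ} (h : f =ᵐ[volume] s.indicator w) :
    ENNReal.ofReal (‖f‖ ^ 2) = ∫⁻ x in s, ‖w x‖ₑ ^ 2 := by
  rw [ofReal_norm_sq_eq_lintegral, ← lintegral_indicator hs]
  refine lintegral_congr_ae ?_
  filter_upwards [h] with x hx
  rw [hx]
  by_cases hc : x ∈ s <;> simp [hc]

/-- The structure of the error: it is the convolution with the kernel outside of the cube, and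
minus the sum of its nontrivial translates on the cube. -/
lemma errorOp_bounds {P : MvPolynomial (Fin m) ℂ} {α : Fin m →₀ ℕ} {a C d B : ℝ}
    (ha : 0 < a) (hd : 0 < d) (hP : ∀ ξ : RR m, symbol P ξ ≠ 0) (hK : KernelBound P α a C)
    {v : RR m → ℂ} (hv : Continuous v) (hB : ∀ x, ‖v x‖ ≤ B)
    (hv0 : ∀ᵐ x, x ∉ cube m d → v x = 0) (u : L2 m) :
    ENNReal.ofReal (‖(indOp (cube m d)ᶜ).comp (errorOp P d α v) u‖ ^ 2) ≤
      ENNReal.ofReal (Real.exp (-(2 * a * d)) * (C ^ 2 / a ^ m) *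
        ∫ y in cube m d, ‖v y‖ ^ 2 * e1 a d y) * ENNReal.ofReal (‖u‖ ^ 2) ∧
    ENNReal.ofReal (‖(indOp (cube m d)).comp (errorOp P d α v) u‖ ^ 2) ≤
      ENNReal.ofReal (‖(indOp (cube m d)ᶜ).comp (errorOp P d α v) u‖ ^ 2) +
      ENNReal.ofReal (C ^ 2) * crossTotal m (2 * a * d) *
        (ENNReal.ofReal (2 ^ m * ∫ y in cube m d, ‖v y‖ ^ 2 * e2 a y) *
          ENNReal.ofReal (‖u‖ ^ 2)) * volume (cube m d) := by
  obtain ⟨k, hki, hk, hkF⟩ := hK.exists_kernel ha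
  have hC := hK.nonneg
  have hkC := norm_le_const_of_kernel ha hC hk
  obtain ⟨Bσ, hBσ⟩ := hK.exists_bound ha
  have hσ := memLp_resSymbol ha hP hK
  have hvtop : MemLp v ∞ (volume : Measure (RR m)) :=
    memLp_top_of_bound hv.aestronglyMeasurable B (.of_forall hB)
  set v' : RR m → ℂ := fun x => (starRingEnd ℂ) (v x) with hv'
  have hv'c : Continuous v' := Complex.continuous_conj.comp hv
  have hv'n : ∀ x, ‖v' x‖ = ‖v x‖ := fun x => by simp [hv']
  have hv'B : ∀ x, ‖v' x‖ ≤ B := fun x => (hv'n x).trans_le (hB x)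
  have hv'top : MemLp v' ∞ (volume : Measure (RR m)) :=
    memLp_top_of_bound hv'c.aestronglyMeasurable B (.of_forall hv'B)
  have hum : Measurable u := (Lp.stronglyMeasurable u).measurable
  set g : RR m → ℂ := fun x => v' x * u x with hg
  have hgm : Measurable g := hv'c.measurable.mul hum
  have hg0 : ∀ᵐ x, x ∉ cube m d → g x = 0 := by
    filter_upwards [hv0] with x hx hc
    simp [hg, hv', hx hc]
  have hgae := mulOp_coeFn hv'top u
  have hg2 : MemLp g 2 (volume : Measure (RR m)) := (Lp.memLp (mulOp v' u)).ae_eq hgae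
  have hg1 : Integrable g := by
    have h1 : IntegrableOn g (cube m d) := by
      have : IsFiniteMeasure (volume.restrict (cube m d)) :=
        ⟨by simpa using volume_cube_lt_top m d⟩
      exact (hg2.restrict (cube m d)).integrable (by norm_num)
    rw [← integrable_indicator_iff (measurableSet_cube m d)] at h1
    refine h1.congr ?_
    filter_upwards [hg0] with x hx
    by_cases hc : x ∈ cube m d
    · rw [Set.indicator_of_mem hc]
    · rw [Set.indicator_of_notMem hc, hx hc]
  set w := convFun k g with hw
  have hwi : Integrable w := integrable_convFun hki hg1
  have hw2 : MemLp w 2 (volume : Measure (RR m)) := memLp_convFun hki hkC hg1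
  have hU : ∫⁻ y, ‖u y‖ₑ ^ 2 = ENNReal.ofReal (‖u‖ ^ 2) := (ofReal_norm_sq_eq_lintegral u).symm
  have hout : ∫⁻ x in (cube m d)ᶜ, ‖w x‖ₑ ^ 2 ≤
      ENNReal.ofReal (Real.exp (-(2 * a * d)) * (C ^ 2 / a ^ m) *
        ∫ y in cube m d, ‖v y‖ ^ 2 * e1 a d y) * ENNReal.ofReal (‖u‖ ^ 2) := by
    have := lintegral_compl_cube_convFun_le ha hC hk hv'c hv'B hum hg0
    simpa only [hv'n, hU] using this
  have hin : ∫⁻ x in cube m d, shiftSum d w x ^ 2 ≤ (∫⁻ x in (cube m d)ᶜ, ‖w x‖ₑ ^ 2) +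
      ENNReal.ofReal (C ^ 2) * crossTotal m (2 * a * d) *
        (ENNReal.ofReal (2 ^ m * ∫ y in cube m d, ‖v y‖ ^ 2 * e2 a y) *
          ENNReal.ofReal (‖u‖ ^ 2)) * volume (cube m d) := by
    refine (lintegral_cube_shiftSum_sq_le ha hd hC hk hwi.aemeasurable hgm.aemeasurable
      hg0).trans ?_
    have := lintegral_exp_mul_sq_le (a := a) (d := d) hv'c hv'B hum
    simp only [hv'n, hU] at this
    gcongr
  -- The quantitative bound also shows that the periodization is a well-defined `L²` function on the
  -- cube.
  have hfin : ∫⁻ x in cube m d, shiftSum d w x ^ 2 ≠ ∞ := by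
    have hT : crossTotal m (2 * a * d) ≠ ∞ :=
      ne_top_of_le_ne_top (ENNReal.mul_ne_top ENNReal.ofReal_ne_top
        (ENNReal.pow_ne_top (latticeConst_ne_top m))) (crossTotal_le m (by positivity))
    refine ne_top_of_le_ne_top (ENNReal.add_ne_top.2 ⟨ne_top_of_le_ne_top
      (ENNReal.mul_ne_top ENNReal.ofReal_ne_top ENNReal.ofReal_ne_top) hout, ?_⟩) hin
    exact ENNReal.mul_ne_top (ENNReal.mul_ne_top (ENNReal.mul_ne_top ENNReal.ofReal_ne_top hT)
      (ENNReal.mul_ne_top ENNReal.ofReal_ne_top ENNReal.ofReal_ne_top)) (volume_cube_lt_top m d).ne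
  have hE2 := memLp_shiftTsum hwi.1 hfin
  have hw2' : MemLp ((cube m d).indicator w) 2 (volume : Measure (RR m)) :=
    hw2.indicator (measurableSet_cube m d)
  have hW2 : MemLp ((cube m d).indicator fun x => w x + shiftTsum d w x) 2
      (volume : Measure (RR m)) := by
    refine (hw2'.add hE2).ae_eq (.of_forall fun x => ?_)
    by_cases hc : x ∈ cube m d <;> simp [hc]
  have hmul : ContinuousLinearMap.adjoint (mulOp v) u = hg2.toLp g := by
    rw [adjoint_mulOp hvtop]
    refine Lp.ext ?_
    filter_upwards [hgae, hg2.coeFn_toLp] with x h1 h2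
    rw [h1, h2]
  have hconv : ContinuousLinearMap.adjoint (derivInv P α) (hg2.toLp g) = hw2.toLp w := by
    rw [derivInv, adjoint_fourierMult hσ, ← hkF]
    refine fourierMult_toLp hki hkC hg1 hg2 ?_
    rw [hkF]
    exact hσ.star
  -- The coefficients match: as `g` lives on the cube, `𝓕 g (ñ)` is `|Ω₀|` times its Fourier
  -- coefficient, and `𝓕 w = 𝓕 k · 𝓕 g`.
  have hKop : Kop P d α (hg2.toLp g) = hW2.toLp _ := by
    refine periodicOp_eq hd (C := Bσ) (fun n => by simpa using hBσ (tilde d n))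
      (toLp_cube_indicator_ae_eq_zero hW2) fun n => ?_
    have hgs : fourierSeries d (hg2.toLp g) n = fourierSeries d g n := by
      refine fourierSeries_congr ?_ n
      filter_upwards [hg2.coeFn_toLp] with x hx _
      exact hx
    have hgF : 𝓕 g (tilde d n) = ∫ x in cube m d, g x * Complex.exp (-phase d n x) := by
      rw [fourier_tilde, ← integral_indicator (measurableSet_cube m d)]
      refine integral_congr_ae ?_
      filter_upwards [hg0] with x hx
      by_cases hc : x ∈ cube m d
      · rw [Set.indicator_of_mem hc]
      · rw [Set.indicator_of_notMem hc, hx hc, zero_mul]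
    rw [fourierSeries_toLp_indicator, fourierSeries_add_shiftTsum hd hwi hfin, hgs, hw,
      fourier_convFun hki hg1, hkF, hgF, fourierSeries]
    ring
  have herr : errorOp P d α v u = hw2.toLp w - hW2.toLp _ := by
    rw [errorOp, ContinuousLinearMap.comp_apply, hmul, sub_apply, hconv, hKop]
  have herr' : errorOp P d α v u =ᵐ[volume]
      fun x => w x - (cube m d).indicator (fun x => w x + shiftTsum d w x) x := by
    rw [herr]
    filter_upwards [Lp.coeFn_sub (hw2.toLp w) (hW2.toLp _), hw2.coeFn_toLp, hW2.coeFn_toLp]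
      with x h1 h2 h3
    rw [h1, Pi.sub_apply, h2, h3]
  have hmc := (measurableSet_cube m d).compl
  have hoe : ENNReal.ofReal (‖(indOp (cube m d)ᶜ).comp (errorOp P d α v) u‖ ^ 2) =
      ∫⁻ x in (cube m d)ᶜ, ‖w x‖ₑ ^ 2 := by
    refine norm_sq_of_ae_eq_indicator hmc ?_
    filter_upwards [indOp_coeFn hmc (errorOp P d α v u), herr'] with x h1 h2
    rw [ContinuousLinearMap.comp_apply, h1]
    by_cases hc : x ∈ cube m d
    · simp [hc]
    · simp [hc, h2]
  have hie : ENNReal.ofReal (‖(indOp (cube m d)).comp (errorOp P d α v) u‖ ^ 2) =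
      ∫⁻ x in cube m d, ‖-shiftTsum d w x‖ₑ ^ 2 := by
    refine norm_sq_of_ae_eq_indicator (measurableSet_cube m d) ?_
    filter_upwards [indOp_coeFn (measurableSet_cube m d) (errorOp P d α v u), herr'] with x h1 h2
    rw [ContinuousLinearMap.comp_apply, h1]
    by_cases hc : x ∈ cube m d
    · simp [hc, h2]
    · simp [hc]
  rw [hoe, hie]
  refine ⟨hout, le_trans (lintegral_mono fun x => ?_) hin⟩
  simp only [enorm_neg]
  exact pow_le_pow_left' (enorm_shiftTsum_le d w x) 2

/-- The bound of `Z_{u,1}`. -/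
lemma Zu1_sq_le {P : MvPolynomial (Fin m) ℂ} {α : Fin m →₀ ℕ} {a C d B : ℝ}
    (ha : 0 < a) (hd : 0 < d) (hP : ∀ ξ : RR m, symbol P ξ ≠ 0) (hK : KernelBound P α a C)
    {v : RR m → ℂ} (hv : Continuous v) (hB : ∀ x, ‖v x‖ ≤ B)
    (hv0 : ∀ᵐ x, x ∉ cube m d → v x = 0) :
    Zu1 P d α v ^ 2 ≤ Real.exp (-(2 * a * d)) * (C ^ 2 / a ^ m) *
        ∫ y in cube m d, ‖v y‖ ^ 2 * e1 a d y := by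
  have hI : 0 ≤ ∫ y in cube m d, ‖v y‖ ^ 2 * e1 a d y :=
    setIntegral_nonneg (measurableSet_cube m d) fun y hy =>
      mul_nonneg (by positivity) (e1_nonneg ha hy)
  refine opNorm_sq_le (by positivity) fun u => ?_
  have h := (errorOp_bounds ha hd hP hK hv hB hv0 u).1
  rwa [← ENNReal.ofReal_mul (by positivity), ENNReal.ofReal_le_ofReal_iff (by positivity)] at h

/-- The bound of `Z_{u,2}` in terms of `Z_{u,1}`. -/
lemma Zu2_sq_le {P : MvPolynomial (Fin m) ℂ} {α : Fin m →₀ ℕ} {a C d B : ℝ}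
    (ha : 0 < a) (hd : 0 < d) (hP : ∀ ξ : RR m, symbol P ξ ≠ 0) (hK : KernelBound P α a C)
    {v : RR m → ℂ} (hv : Continuous v) (hB : ∀ x, ‖v x‖ ≤ B)
    (hv0 : ∀ᵐ x, x ∉ cube m d → v x = 0) :
    Zu2 P d α v ^ 2 ≤ Zu1 P d α v ^ 2 + Real.exp (-(4 * a * d)) *
      (tailBound m (2 * a * d) * ((latticeConst m).toReal ^ 2 + 1) * (4 * d) ^ m) * C ^ 2 *
        ∫ y in cube m d, ‖v y‖ ^ 2 * e2 a y := by
  set I := ∫ y in cube m d, ‖v y‖ ^ 2 * e2 a y with hI'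
  have hI : 0 ≤ I := setIntegral_nonneg (measurableSet_cube m d) fun y _ =>
    mul_nonneg (by positivity) (e2_pos a y).le
  have hT : 0 ≤ tailBound m (2 * a * d) := by unfold tailBound; positivity
  refine opNorm_sq_le (by positivity) fun u => ?_
  have h := (errorOp_bounds ha hd hP hK hv hB hv0 u).2
  rw [← hI'] at h
  set X := ‖(indOp (cube m d)).comp (errorOp P d α v) u‖
  set Y := ‖(indOp (cube m d)ᶜ).comp (errorOp P d α v) u‖
  have hL : latticeConst m ^ 2 ≤ ENNReal.ofReal ((latticeConst m).toReal ^ 2 + 1) := by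
    rw [← ENNReal.ofReal_toReal (ENNReal.pow_ne_top (latticeConst_ne_top m)), ENNReal.toReal_pow]
    exact ENNReal.ofReal_le_ofReal (by linarith)
  have hct := (crossTotal_le m (t := 2 * a * d) (by positivity)).trans (mul_le_mul' le_rfl hL)
  have h2 : ENNReal.ofReal (X ^ 2) ≤ ENNReal.ofReal (Y ^ 2 + (C ^ 2 *
      (Real.exp (-(2 * (2 * a * d))) * tailBound m (2 * a * d) *
        ((latticeConst m).toReal ^ 2 + 1)) * (2 ^ m * I * ‖u‖ ^ 2) * (2 * d) ^ m)) := by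
    refine h.trans ?_
    rw [ENNReal.ofReal_add (by positivity) (by positivity),
      ENNReal.ofReal_mul (q := (2 * d) ^ m) (by positivity),
      ENNReal.ofReal_mul (q := 2 ^ m * I * ‖u‖ ^ 2) (by positivity),
      ENNReal.ofReal_mul (q := ‖u‖ ^ 2) (by positivity), ENNReal.ofReal_mul (p := C ^ 2)
        (by positivity), volume_cube, ← ENNReal.ofReal_pow (by positivity),
      ENNReal.ofReal_mul (q := (latticeConst m).toReal ^ 2 + 1) (by positivity)]
    gcongr
  rw [ENNReal.ofReal_le_ofReal_iff (by positivity)] at h2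
  have hYu : Y ^ 2 ≤ Zu1 P d α v ^ 2 * ‖u‖ ^ 2 := by
    rw [← mul_pow]
    exact pow_le_pow_left₀ (norm_nonneg _) (ContinuousLinearMap.le_opNorm _ u) 2
  -- The factor `2^m` comes from comparing `e^{2a|y|₁}` with `e2`, and `(2d)^m` is the volume of the
  -- cube.
  have e4 : (4 * d) ^ m = 2 ^ m * (2 * d) ^ m := by rw [← mul_pow]; ring
  have ee : Real.exp (-(2 * (2 * a * d))) = Real.exp (-(4 * a * d)) := by ring_nf
  rw [ee] at h2
  rw [e4]
  calc X ^ 2 ≤ _ := h2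
    _ ≤ _ := add_le_add_left hYu _
    _ = _ := by ring

end Bounds

/-! ### Exponential decay in the size of the cube -/

section Decay

variable {m : ℕ}

/-- The weighted norm sees only the fixed cube that carries `v`, so the bound does not involve `d`.
-/
lemma setIntegral_le_of_support {v : RR m → ℂ} {e : RR m → ℝ} {d₀ d B D : ℝ} (hd : d₀ ≤ d)
    (hB : ∀ x, ‖v x‖ ≤ B) (hv0 : ∀ᵐ x, x ∉ cube m d₀ → v x = 0)
    (he0 : ∀ x ∈ cube m d₀, 0 ≤ e x) (he : ∀ x ∈ cube m d₀, e x ≤ D) :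
    ∫ y in cube m d, ‖v y‖ ^ 2 * e y ≤ B ^ 2 * D * volume.real (cube m d₀) := by
  have hsub : cube m d₀ ⊆ cube m d := fun x hx i =>
    ⟨by linarith [(hx i).1], by linarith [(hx i).2]⟩
  have h1 : ∫ y in cube m d, ‖v y‖ ^ 2 * e y = ∫ y in cube m d₀, ‖v y‖ ^ 2 * e y := by
    refine setIntegral_eq_of_subset_of_ae_sdiff_eq_zero (measurableSet_cube m d).nullMeasurableSet
      hsub ?_
    filter_upwards [hv0] with x hx hc
    simp [hx hc.2]
  rw [h1]
  refine (Real.le_norm_self _).trans (norm_setIntegral_le_of_norm_le_const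
    (volume_cube_lt_top m d₀) fun x hx => ?_)
  have := he0 x hx
  have := he x hx
  have := hB x
  rw [Real.norm_of_nonneg (by positivity)]
  gcongr

lemma tailBound_antitone {s t : ℝ} (hs : 0 < s) (hst : s ≤ t) :
    tailBound m t ≤ tailBound m s := by
  unfold tailBound
  gcongr

/-- From `s^m / m! ≤ e^s` with `s = 2ad` and `4d = (2/a) s`. -/
lemma exp_neg_mul_pow_le {a d : ℝ} (ha : 0 < a) (hd : 0 < d) :
    Real.exp (-(2 * a * d)) * (4 * d) ^ m ≤ m.factorial * (2 / a) ^ m := by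
  have h := Real.pow_div_factorial_le_exp (2 * a * d) (by positivity) m
  rw [div_le_iff₀ (by positivity)] at h
  have e : (4 * d) ^ m = (2 / a) ^ m * (2 * a * d) ^ m := by
    rw [← mul_pow]; congr 1; field_simp; ring
  rw [Real.exp_neg, inv_mul_le_iff₀ (Real.exp_pos _), e]
  calc (2 / a) ^ m * (2 * a * d) ^ m ≤ (2 / a) ^ m * (Real.exp (2 * a * d) * m.factorial) := by
        gcongr
    _ = _ := by ring

lemma exists_decay {P : MvPolynomial (Fin m) ℂ} {α : Fin m →₀ ℕ} {a C d₀ B : ℝ}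
    (ha : 0 < a) (hd₀ : 0 < d₀) (hP : ∀ ξ : RR m, symbol P ξ ≠ 0) (hK : KernelBound P α a C)
    {v : RR m → ℂ} (hv : Continuous v) (hB : ∀ x, ‖v x‖ ≤ B)
    (hv0 : ∀ᵐ x, x ∉ cube m d₀ → v x = 0) :
    ∃ M : ℝ, ∀ d, d₀ ≤ d →
      Real.sqrt (Zu1 P d α v ^ 2 + Zu2 P d α v ^ 2) ≤ M * Real.exp (-(a * d)) := by
  set I₁ := B ^ 2 * (m * Real.cosh (2 * a * d₀)) * volume.real (cube m d₀)
  set I₂ := B ^ 2 * Real.cosh (2 * a * d₀) ^ m * volume.real (cube m d₀)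
  set S := (latticeConst m).toReal ^ 2 + 1
  -- The outer bound enters twice, once for `Zu1` and once inside the bound of `Zu2`. In the last
  -- term, one of the two factors `e^{-2ad}` in `e^{-4ad}` has absorbed `(4d)^m`.
  set M := 2 * ((C ^ 2 / a ^ m) * I₁) +
    tailBound m (2 * a * d₀) * S * (m.factorial * (2 / a) ^ m) * C ^ 2 * I₂
  refine ⟨Real.sqrt M, fun d hd => ?_⟩
  have hd' : 0 < d := hd₀.trans_le hd
  have hv0' : ∀ᵐ x, x ∉ cube m d → v x = 0 := by
    filter_upwards [hv0] with x hx hc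
    exact hx fun h => hc fun i => ⟨by linarith [(h i).1], by linarith [(h i).2]⟩
  have h1 := Zu1_sq_le ha hd' hP hK hv hB hv0'
  have h2 := Zu2_sq_le ha hd' hP hK hv hB hv0'
  have i1 : ∫ y in cube m d, ‖v y‖ ^ 2 * e1 a d y ≤ I₁ :=
    setIntegral_le_of_support hd hB hv0
      (fun x hx => e1_nonneg ha fun i => ⟨by linarith [(hx i).1], by linarith [(hx i).2]⟩)
      fun x hx => e1_le ha hd hx
  have i2 : ∫ y in cube m d, ‖v y‖ ^ 2 * e2 a y ≤ I₂ :=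
    setIntegral_le_of_support hd hB hv0 (fun x _ => (e2_pos a x).le) fun x hx => e2_le hx
  have hI₂ : 0 ≤ I₂ := by
    have := Real.cosh_pos (2 * a * d₀)
    positivity
  have hT : ∀ t, 0 < t → 0 ≤ tailBound m t := fun t ht => by unfold tailBound; positivity
  have hT1 := hT (2 * a * d) (by positivity)
  have hT0 := hT (2 * a * d₀) (by positivity)
  have hTT : tailBound m (2 * a * d) ≤ tailBound m (2 * a * d₀) :=
    tailBound_antitone (by positivity) (by gcongr)
  have j1 : Zu1 P d α v ^ 2 ≤ Real.exp (-(2 * a * d)) * ((C ^ 2 / a ^ m) * I₁) := by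
    refine h1.trans ?_
    rw [mul_assoc]
    gcongr
  have hexp : Real.exp (-(4 * a * d)) = Real.exp (-(2 * a * d)) * Real.exp (-(2 * a * d)) := by
    rw [← Real.exp_add]; ring_nf
  have j2 : Real.exp (-(4 * a * d)) * (tailBound m (2 * a * d) * S * (4 * d) ^ m) * C ^ 2 *
        ∫ y in cube m d, ‖v y‖ ^ 2 * e2 a y ≤
      Real.exp (-(2 * a * d)) *
        (tailBound m (2 * a * d₀) * S * (m.factorial * (2 / a) ^ m) * C ^ 2 * I₂) := by
    calc _ = Real.exp (-(2 * a * d)) * (tailBound m (2 * a * d) * S *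
          (Real.exp (-(2 * a * d)) * (4 * d) ^ m) * C ^ 2 *
            ∫ y in cube m d, ‖v y‖ ^ 2 * e2 a y) := by rw [hexp]; ring
      _ ≤ _ := by
        have := exp_neg_mul_pow_le (m := m) ha hd'
        have hi : 0 ≤ ∫ y in cube m d, ‖v y‖ ^ 2 * e2 a y :=
          setIntegral_nonneg (measurableSet_cube m d) fun y _ =>
            mul_nonneg (by positivity) (e2_pos a y).le
        gcongr
  have htot : Zu1 P d α v ^ 2 + Zu2 P d α v ^ 2 ≤ M * Real.exp (-(a * d)) ^ 2 := by
    have : Real.exp (-(a * d)) ^ 2 = Real.exp (-(2 * a * d)) := by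
      rw [← Real.exp_nat_mul]; push_cast; ring_nf
    rw [this]
    calc _ ≤ 2 * (Real.exp (-(2 * a * d)) * ((C ^ 2 / a ^ m) * I₁)) +
          Real.exp (-(2 * a * d)) *
          (tailBound m (2 * a * d₀) * S * (m.factorial * (2 / a) ^ m) * C ^ 2 * I₂) := by
          linarith
      _ = _ := by ring
  refine (Real.sqrt_le_sqrt htot).trans_eq ?_
  rw [Real.sqrt_mul' _ (sq_nonneg _), Real.sqrt_sq (Real.exp_nonneg _)]

/-- The rational function in the bound of `Z_{u,2}`. -/
lemma exists_polynomial_div_eq (m : ℕ) {a : ℝ} (ha : 0 < a) {S : ℝ} (hS : 0 < S) :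
    ∃ p q : Polynomial ℝ, (∀ d : ℝ, 0 < d → 0 < p.eval d ∧ 0 < q.eval d) ∧
      ∀ d : ℝ, 0 < d → p.eval d / q.eval d = tailBound m (2 * a * d) * S * (4 * d) ^ m := by
  let X : Polynomial ℝ := Polynomial.X
  -- The denominator clears `t^{4m}` in `tailBound` at `t = 2ad`.
  let q : Polynomial ℝ := (Polynomial.C (2 * a) * X) ^ (4 * m)
  let p : Polynomial ℝ := (Polynomial.C (2 ^ (4 * m)) * q +
    Polynomial.C (((4 * m).factorial : ℝ) * 3 ^ (4 * m))) * Polynomial.C S * (Polynomial.C 4 * X) ^ m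
  have hq : ∀ d, q.eval d = (2 * a * d) ^ (4 * m) := fun d => by simp [q, X]
  have hp : ∀ d, p.eval d = (2 ^ (4 * m) * (2 * a * d) ^ (4 * m) +
      (4 * m).factorial * 3 ^ (4 * m)) * S * (4 * d) ^ m := fun d => by
    simp only [p, X, Polynomial.eval_mul, Polynomial.eval_add, Polynomial.eval_pow,
      Polynomial.eval_C, Polynomial.eval_X, hq]
  refine ⟨p, q, fun d hd => ?_, fun d hd => ?_⟩
  · rw [hp, hq]
    exact ⟨by positivity, by positivity⟩
  · rw [hp, hq, tailBound]
    field_simp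

end Decay

end UnboundedPDE

end

/-! ### Assembly of the bounds and of the decay estimate -/

theorem mainTheorem6 (m : ℕ) (hm : 1 ≤ m) (a : ℝ) (ha : 0 < a) :
    ∃ p q : Polynomial ℝ,
      (∀ d : ℝ, 0 < d → 0 < p.eval d ∧ 0 < q.eval d) ∧
      ∀ (P : MvPolynomial (Fin m) ℂ) (G : UnboundedPDE.Nonlinearity m)
        (u₀ : UnboundedPDE.L2 m) (Cα : (Fin m →₀ ℕ) → ℝ),
        (∀ ξ : UnboundedPDE.RR m, UnboundedPDE.symbol P ξ ≠ 0) →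
        (∀ i ∈ Finset.Icc 2 G.N, ∀ k ∈ G.J i, ∀ r : Fin i,
          MeasureTheory.Integrable fun ξ : UnboundedPDE.RR m =>
            UnboundedPDE.symbol (G.op i k r) ξ / UnboundedPDE.symbol P ξ) →
        (∀ α ∈ G.JG, UnboundedPDE.KernelBound P α a (Cα α)) →
        UnboundedPDE.MemHl P u₀ →
        -- the bounds on a cube that contains the support of `u₀`
        (∀ d : ℝ, 0 < d →
          (∀ᵐ x : UnboundedPDE.RR m, x ∉ UnboundedPDE.cube m d → u₀ x = 0) →
          ∀ α ∈ G.JG, ∀ V : (Fin m → ℤ) → ℂ,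
            V = UnboundedPDE.fourierSeries d (G.v u₀ α) →
            UnboundedPDE.PairingWellDefined V (UnboundedPDE.E1 m a d) ∧
            UnboundedPDE.PairingWellDefined V (UnboundedPDE.E2 m a d) ∧
            UnboundedPDE.Zu1 P d α (G.v u₀ α) ^ 2 ≤
              Real.exp (-(2 * a * d)) *
                MeasureTheory.volume.real (UnboundedPDE.cube m d) * (Cα α ^ 2 / a ^ m) *
                UnboundedPDE.pairing V (UnboundedPDE.E1 m a d) ∧
            UnboundedPDE.Zu2 P d α (G.v u₀ α) ^ 2 ≤
              UnboundedPDE.Zu1 P d α (G.v u₀ α) ^ 2 +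
              Real.exp (-(4 * a * d)) * (p.eval d / q.eval d) * Cα α ^ 2 *
                MeasureTheory.volume.real (UnboundedPDE.cube m d) *
                UnboundedPDE.pairing V (UnboundedPDE.E2 m a d)) ∧
        -- exponential decay of the error in the size of the cube
        (∀ d₀ : ℝ, 0 < d₀ →
          (∀ᵐ x : UnboundedPDE.RR m, x ∉ UnboundedPDE.cube m d₀ → u₀ x = 0) →
          ∃ M : ℝ, ∀ d : ℝ, d₀ ≤ d →
            ∑ α ∈ G.JG, Real.sqrt (UnboundedPDE.Zu1 P d α (G.v u₀ α) ^ 2 +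
              UnboundedPDE.Zu2 P d α (G.v u₀ α) ^ 2) ≤ M * Real.exp (-(a * d))) := by
  -- The summand `1` makes the positivity of the rational function immediate. Only `m` and `a` enter
  -- it, and it is fixed before the operators.
  set S : ℝ := (UnboundedPDE.latticeConst m).toReal ^ 2 + 1 with hS
  obtain ⟨p, q, hpos, hpq⟩ := UnboundedPDE.exists_polynomial_div_eq m ha
    (by positivity : 0 < S)
  refine ⟨p, q, hpos, fun P G u₀ Cα hP hG hK hu₀ => ?_⟩
  have hint : ∀ i ∈ Finset.Icc 2 G.N, ∀ k ∈ G.J i, ∀ r : Fin i, Integrable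
      fun ξ : UnboundedPDE.RR m => UnboundedPDE.symbol (G.op i k r) ξ *
        (𝓕 u₀ : UnboundedPDE.L2 m) ξ := by
    intro i hi k hk r
    refine UnboundedPDE.integrable_symbol_mul_fourier hP (hG i hi k hk r)
      (UnboundedPDE.exists_bound_symbol_div ha fun β hβ => hK β ?_) hu₀
    simp only [UnboundedPDE.Nonlinearity.JG, Finset.mem_biUnion]
    exact ⟨i, hi, k, hk, r, Finset.mem_univ r, hβ⟩
  have hv : ∀ α, Continuous (G.v u₀ α) := UnboundedPDE.Nonlinearity.continuous_v hint
  refine ⟨fun d hd hsupp α hα V hV => ?_, fun d₀ hd₀ hsupp => ?_⟩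
  · subst hV
    obtain ⟨B, hB⟩ := G.exists_bound_v u₀ α
    have hv0 := UnboundedPDE.Nonlinearity.v_eq_zero_off_cube hint α hsupp
    obtain ⟨w1, i1⟩ := UnboundedPDE.pairing_eq hd (hv α).aestronglyMeasurable
      (UnboundedPDE.continuous_e1 a d) (fun x _ => hB x)
      (fun x hx => by
        rw [abs_of_nonneg (UnboundedPDE.e1_nonneg ha hx)]
        exact UnboundedPDE.e1_le ha le_rfl hx)
      fun x hx => UnboundedPDE.e1_nonneg ha hx
    obtain ⟨w2, i2⟩ := UnboundedPDE.pairing_eq hd (hv α).aestronglyMeasurable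
      (UnboundedPDE.continuous_e2 a) (fun x _ => hB x)
      (fun x hx => by
        rw [abs_of_pos (UnboundedPDE.e2_pos a x)]
        exact UnboundedPDE.e2_le hx)
      fun x _ => (UnboundedPDE.e2_pos a x).le
    have z1 := UnboundedPDE.Zu1_sq_le ha hd hP (hK α hα) (hv α) hB hv0
    have z2 := UnboundedPDE.Zu2_sq_le ha hd hP (hK α hα) (hv α) hB hv0
    refine ⟨w1, w2, z1.trans_eq ?_, z2.trans_eq ?_⟩
    · rw [← i1, UnboundedPDE.E1]
      ring
    · rw [← i2, hpq d hd, UnboundedPDE.E2]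
      ring
  · have hdecay : ∀ α, ∃ M : ℝ, α ∈ G.JG → ∀ d, d₀ ≤ d →
        Real.sqrt (UnboundedPDE.Zu1 P d α (G.v u₀ α) ^ 2 +
          UnboundedPDE.Zu2 P d α (G.v u₀ α) ^ 2) ≤ M * Real.exp (-(a * d)) := by
      intro α
      by_cases hα : α ∈ G.JG
      · obtain ⟨B, hB⟩ := G.exists_bound_v u₀ α
        exact (UnboundedPDE.exists_decay ha hd₀ hP (hK α hα) (hv α) hB
          (UnboundedPDE.Nonlinearity.v_eq_zero_off_cube hint α hsupp)).imp fun M hM _ => hM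
      · exact ⟨0, fun h => absurd h hα⟩
    choose M hM using hdecay
    refine ⟨∑ α ∈ G.JG, M α, fun d hd => ?_⟩
    rw [Finset.sum_mul]
    exact Finset.sum_le_sum fun α hα => hM α hα d hd
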